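/- For a positive integer $m$, let $\omega(m)$ denote the number of distinct prime factors of $m$, and let $\Omega(m)$ denote the number of prime factors of $m$ counted with multiplicity. There exists a positive absolute constant $C$ such that, for infinitely many positive integers $n$, one has $$\omega(n+k) \le \Omega(n+k) \le C\log k$$ for every integer $k \ge 2$. -/

import Mathlib

/-!
For which `n` is `Ω(n + k) ≤ C log k` for all `k ≥ 2`? A typical integer near `x` has about `log log x`
prime factors, so a random `n` is good enough once `k` is a power of `log x`, and the smaller `k` have
to be helped along. Two devices do this.

* Let `n` be a multiple of `M = smoothModulus t`, which is divisible by a high power of every small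
  prime. Then `n + k = g * m` with `g = gcd(M, k)`, so that `Ω(g) ≤ log₂ k`, and for moderate `k` the
  number `m = roughPart t k` has no small prime factor at all.
* With `l = log₂ k`, require that `m` has no prime factor below `2 ^ 4 ^ (t - l)`, where `2 ^ 4 ^ t` is
  a fixed power of `x`. The primes that remain allowed have a reciprocal sum of `O(l)`, so that
  `Ω(m)` should be `O(l)` too, except with a probability exponentially small in `l`.

A prime of `[2 ^ 4 ^ (t - j), 2 ^ 4 ^ (t - j + 1))` then has to avoid only those residue classes that
come from `k < 2 ^ j`. The sieving density `2 ^ j` thus grows much more slowly than the logarithm of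
the primes decreases, and the Brun–Hooley sieve applies: in each of these blocks, inclusion-exclusion
is truncated at a degree that is a large multiple of `2 ^ j`, and the moduli that occur still multiply
to a fixed power of `2 ^ 4 ^ t`. By Bonferroni's inequalities (`symmPoly_bonferroni`) this gives a lower
bound for the number of sifted `n` (`IsBlockSieve.le_sum_prod`), and an upper bound of the same order
for those with an additional condition modulo `d` (`IsBlockSieve.sum_weighted_prod_le`). The main
terms are computed in `abs_sum_prod_symmPoly_sub_le`.

If `Ω(m)` is large, then `m` has a divisor `d ≤ 2 ^ 4 ^ t` with exactly `R * l` prime factors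
(`exists_dvd_cardFactors_eq_pow_le`). Summing the upper bound over such `d` by Rankin's trick
(`sum_inv_le_of_cardFactors_eq`) and then over `k`, one finds that most of the sifted `n` have no such
divisor for any `k` (`exists_sifted`). For `k ≥ 2 ^ 4 ^ t` the size of `n + k` alone suffices.
-/

open Finset

/-! ### Reciprocal sums over primes, and small divisors -/

theorem sum_inv_primes_dyadic_le (i : ℕ) (hi : 0 < i) :
    ∑ p ∈ (Ico (2 ^ i) (2 ^ (i + 1))).filter Nat.Prime, (1 / p : ℝ) ≤ 4 / i := by
  set A := (Ico (2 ^ i) (2 ^ (i + 1))).filter Nat.Prime with hA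
  have h1 : (2 ^ i) ^ #A ≤ 4 ^ (2 ^ (i + 1)) := by
    calc (2 ^ i) ^ #A = ∏ _p ∈ A, 2 ^ i := by simp
      _ ≤ ∏ p ∈ A, p := prod_le_prod' fun p hp => by
          simp only [hA, mem_filter, mem_Ico] at hp; exact hp.1.1
      _ ≤ primorial (2 ^ (i + 1)) := by
          refine prod_le_prod_of_subset_of_one_le' (fun p hp => ?_) (fun p hp _ => ?_)
          · simp only [hA, mem_filter, mem_Ico] at hp
            simp only [mem_filter, mem_range]
            exact ⟨by omega, hp.2⟩
          · exact (mem_filter.1 hp).2.one_lt.le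
      _ ≤ 4 ^ (2 ^ (i + 1)) := primorial_le_four_pow _
  have h2 : i * #A ≤ 2 * 2 ^ (i + 1) := by
    rw [← pow_mul, show (4 : ℕ) = 2 ^ 2 by rfl, ← pow_mul] at h1
    exact (Nat.pow_le_pow_iff_right (by norm_num)).1 h1
  have h3 : (i : ℝ) * #A ≤ 4 * 2 ^ i := by
    have : ((i * #A : ℕ) : ℝ) ≤ ((2 * 2 ^ (i + 1) : ℕ) : ℝ) := by exact_mod_cast h2
    push_cast at this
    rw [pow_succ] at this
    linarith
  have hi' : (0 : ℝ) < i := by exact_mod_cast hi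
  calc ∑ p ∈ A, (1 / p : ℝ) ≤ ∑ _p ∈ A, (1 / 2 ^ i : ℝ) := by
        refine sum_le_sum fun p hp => ?_
        simp only [hA, mem_filter, mem_Ico] at hp
        refine one_div_le_one_div_of_le (by positivity) ?_
        exact_mod_cast hp.1.1
    _ = #A / 2 ^ i := by simp [div_eq_mul_inv]
    _ ≤ 4 / i := by
        rw [div_le_div_iff₀ (by positivity) hi']
        linarith

theorem sum_filter_Ico_consecutive (P : ℕ → Prop) [DecidablePred P] (f : ℕ → ℝ) {a b c : ℕ}
    (hab : a ≤ b) (hbc : b ≤ c) :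
    ∑ p ∈ (Ico a c).filter P, f p =
      ∑ p ∈ (Ico a b).filter P, f p + ∑ p ∈ (Ico b c).filter P, f p := by
  simp only [sum_filter]
  exact (sum_Ico_consecutive _ hab hbc).symm

theorem sum_inv_primes_two_pow_le (a l : ℕ) (ha : 0 < a) :
    ∑ p ∈ (Ico (2 ^ a) (2 ^ (a + l))).filter Nat.Prime, (1 / p : ℝ) ≤ 4 * l / a := by
  induction l with
  | zero => simp
  | succ l ih =>
    rw [sum_filter_Ico_consecutive Nat.Prime _ (b := 2 ^ (a + l))
      (Nat.pow_le_pow_right (by norm_num) (by omega))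
      (Nat.pow_le_pow_right (by norm_num) (by omega))]
    have h := sum_inv_primes_dyadic_le (a + l) (by omega)
    have h2 : (4 : ℝ) / ((a + l : ℕ) : ℝ) ≤ 4 / a := by
      have : (0 : ℝ) < a := by exact_mod_cast ha
      refine div_le_div_of_nonneg_left (by norm_num) this ?_
      push_cast
      linarith [(Nat.cast_nonneg l : (0 : ℝ) ≤ l)]
    calc _ ≤ 4 * (l : ℝ) / a + 4 / a := add_le_add ih (h.trans h2)
      _ = 4 * ((l + 1 : ℕ) : ℝ) / a := by push_cast; ring

/-- Between `2 ^ 4 ^ i` and `2 ^ 4 ^ (i + l)` there are `l` blocks, and Chebyshev's upper bound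
gives each of them a reciprocal sum over primes of at most `12`. -/
theorem sum_inv_primes_two_pow_four_pow_le (i l : ℕ) :
    ∑ p ∈ (Ico (2 ^ 4 ^ i) (2 ^ 4 ^ (i + l))).filter Nat.Prime, (1 / p : ℝ) ≤ 12 * l := by
  induction l with
  | zero => simp
  | succ l ih =>
    rw [sum_filter_Ico_consecutive Nat.Prime _ (b := 2 ^ 4 ^ (i + l))
      (Nat.pow_le_pow_right (by norm_num) (Nat.pow_le_pow_right (by norm_num) (by omega)))
      (Nat.pow_le_pow_right (by norm_num) (Nat.pow_le_pow_right (by norm_num) (by omega)))]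
    have h := sum_inv_primes_two_pow_le (4 ^ (i + l)) (3 * 4 ^ (i + l)) (by positivity)
    have h1 : 4 ^ (i + l) + 3 * 4 ^ (i + l) = 4 ^ (i + (l + 1)) := by ring
    rw [h1] at h
    have h2 : 4 * ((3 * 4 ^ (i + l) : ℕ) : ℝ) / ((4 ^ (i + l) : ℕ) : ℝ) = 12 := by
      push_cast
      field_simp
      norm_num
    rw [h2] at h
    push_cast
    linarith

/-- Rankin's trick: numbers composed of `r` primes from `s`, counted with multiplicity, have a
small reciprocal sum as soon as `r` is large compared with `∑ p ∈ s, 1 / p`. The weight `3 / 2` is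
below `2`, so that the Euler factor at `2` converges. -/
theorem sum_inv_le_of_cardFactors_eq (s D : Finset ℕ) (r : ℕ) (S : ℝ)
    (hs : ∀ p ∈ s, p.Prime) (hS : ∑ p ∈ s, (1 / p : ℝ) ≤ S)
    (hD : ∀ d ∈ D, d ≠ 0 ∧ ArithmeticFunction.cardFactors d = r ∧ ∀ p, p.Prime → p ∣ d → p ∈ s) :
    ∑ d ∈ D, (1 / d : ℝ) ≤ (2 / 3) ^ r * Real.exp (6 * S) := by
  let f : ℕ →* ℝ :=
    { toFun := fun m => (3 / 2) ^ ArithmeticFunction.cardFactors m / m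
      map_one' := by simp
      map_mul' := fun m n => by
        rcases eq_or_ne m 0 with rfl | hm
        · simp
        rcases eq_or_ne n 0 with rfl | hn
        · simp
        rw [ArithmeticFunction.cardFactors_mul hm hn]
        push_cast
        rw [pow_add]
        field_simp }
  have hf : ∀ m, f m = (3 / 2) ^ ArithmeticFunction.cardFactors m / m := fun m => rfl
  have hf0 : ∀ m, 0 ≤ f m := fun m => by rw [hf]; positivity
  have hfp : ∀ {p : ℕ}, p.Prime → f p = (3 / 2) / p := fun {p} hp => by
    rw [hf, ArithmeticFunction.cardFactors_apply_prime hp, pow_one]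
  have hlt : ∀ {p : ℕ}, p.Prime → ‖f p‖ < 1 := fun {p} hp => by
    have : (2 : ℝ) ≤ p := by exact_mod_cast hp.two_le
    rw [Real.norm_of_nonneg (hf0 p), hfp hp, div_lt_one (by linarith)]
    linarith
  obtain ⟨-, hsum⟩ := EulerProduct.summable_and_hasSum_factoredNumbers_prod_filter_prime_geometric
    (f := f) hlt s
  have hmem : ∀ d ∈ D, d ∈ Nat.factoredNumbers s := fun d hd => by
    obtain ⟨h0, -, hp⟩ := hD d hd
    refine ⟨h0, fun p hpd => ?_⟩
    exact hp p (Nat.prime_of_mem_primeFactorsList hpd) (Nat.dvd_of_mem_primeFactorsList hpd)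
  have h1 : ∑ d ∈ D, f d ≤ ∏ p ∈ s with p.Prime, (1 - f p)⁻¹ := by
    have := sum_le_hasSum (D.subtype (fun d => d ∈ Nat.factoredNumbers s))
      (fun i _ => hf0 i.1) hsum
    rwa [sum_subtype_eq_sum_filter, filter_true_of_mem hmem] at this
  have h2 : ∏ p ∈ s with p.Prime, (1 - f p)⁻¹ ≤ Real.exp (6 * S) := by
    rw [filter_true_of_mem hs]
    calc ∏ p ∈ s, (1 - f p)⁻¹ ≤ ∏ p ∈ s, Real.exp (6 * (1 / p)) := by
          refine prod_le_prod (fun p hp => inv_nonneg.2 ?_) fun p hp => ?_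
          · have := hlt (hs p hp)
            rw [Real.norm_of_nonneg (hf0 p)] at this
            linarith
          · have h2p : (2 : ℝ) ≤ p := by exact_mod_cast (hs p hp).two_le
            refine le_trans ?_ (Real.add_one_le_exp _)
            rw [hfp (hs p hp), show (1 : ℝ) - 3 / 2 / p = (p - 3 / 2) / p by field_simp, inv_div,
              show 6 * (1 / (p : ℝ)) + 1 = (6 + p) / p by field_simp,
              div_le_div_iff₀ (by linarith) (by linarith)]
            nlinarith
      _ = Real.exp (6 * ∑ p ∈ s, (1 / p : ℝ)) := by rw [mul_sum, Real.exp_sum]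
      _ ≤ _ := Real.exp_le_exp.2 (by linarith)
  calc ∑ d ∈ D, (1 / d : ℝ) = (2 / 3) ^ r * ∑ d ∈ D, f d := by
        rw [mul_sum]
        refine sum_congr rfl fun d hd => ?_
        rw [hf, (hD d hd).2.1, mul_div_assoc', ← mul_pow]
        norm_num
    _ ≤ _ := mul_le_mul_of_nonneg_left (h1.trans h2) (by positivity)

/-- Among the products of `r` prime factors of `m`, some `d` is as small as the number of prime
factors of `m` allows. -/
theorem exists_dvd_cardFactors_eq_pow_le (A r : ℕ) {m : ℕ} (hm : m ≠ 0)
    (h : A * r ≤ ArithmeticFunction.cardFactors m) (hA : 0 < A) :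
    ∃ d, d ∣ m ∧ ArithmeticFunction.cardFactors d = r ∧ d ^ A ≤ m := by
  have hex : ∀ {m : ℕ}, m ≠ 0 → r ≤ ArithmeticFunction.cardFactors m →
      ∃ d, d ∣ m ∧ ArithmeticFunction.cardFactors d = r := by
    intro m hm h
    refine ⟨(m.primeFactorsList.take r).prod, ?_, ?_⟩
    · conv_rhs => rw [← Nat.prod_primeFactorsList hm, ← List.prod_take_mul_prod_drop _ r]
      exact dvd_mul_right _ _
    · rw [ArithmeticFunction.cardFactors_apply, (Nat.primeFactorsList_unique rfl
        fun p hp => Nat.prime_of_mem_primeFactorsList (List.mem_of_mem_take hp)).symm.length_eq,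
        List.length_take]
      rw [ArithmeticFunction.cardFactors_apply] at h
      omega
  obtain ⟨A, rfl⟩ : ∃ B, A = B + 1 := ⟨A - 1, by omega⟩
  clear hA
  induction A generalizing m with
  | zero =>
    obtain ⟨d, hd, hr⟩ := hex hm (by simpa using h)
    exact ⟨d, hd, hr, by simpa using Nat.le_of_dvd (Nat.pos_of_ne_zero hm) hd⟩
  | succ A ih =>
    obtain ⟨d, ⟨e, rfl⟩, hr⟩ := hex hm (by nlinarith)
    have hd0 : d ≠ 0 := left_ne_zero_of_mul hm
    have he0 : e ≠ 0 := right_ne_zero_of_mul hm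
    rw [ArithmeticFunction.cardFactors_mul hd0 he0, hr] at h
    obtain ⟨d', hd', hr', hle⟩ := ih he0 (by nlinarith)
    rcases le_total d' d with hdd | hdd
    · refine ⟨d', hd'.mul_left d, hr', ?_⟩
      rw [pow_succ, mul_comm d e]
      exact Nat.mul_le_mul hle hdd
    · refine ⟨d, dvd_mul_right _ _, hr, ?_⟩
      rw [pow_succ, mul_comm d e]
      exact Nat.mul_le_mul_right _ ((Nat.pow_le_pow_left hdd _).trans hle)

theorem cardDistinctFactors_le_cardFactors (n : ℕ) :
    ArithmeticFunction.cardDistinctFactors n ≤ ArithmeticFunction.cardFactors n := by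
  rw [ArithmeticFunction.cardDistinctFactors_apply, ArithmeticFunction.cardFactors_apply]
  exact (List.dedup_sublist _).length_le

theorem cardFactors_le_log {n : ℕ} (hn : n ≠ 0) :
    ArithmeticFunction.cardFactors n ≤ Nat.log 2 n := by
  refine Nat.le_log_of_pow_le (by norm_num) ?_
  conv_rhs => rw [← Nat.prod_primeFactorsList hn]
  rw [ArithmeticFunction.cardFactors_apply]
  exact List.pow_card_le_prod _ _ fun p hp => (Nat.prime_of_mem_primeFactorsList hp).two_le

/-! ### Truncated inclusion-exclusion -/

/-- The multi-affine polynomial `∑ S ⊆ B, c |S| ∏ p ∈ S, x p`: a combination of the elementary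
symmetric functions of the values `x p`, `p ∈ B`, with coefficients `c`. -/
noncomputable def symmPoly (c : ℕ → ℝ) (B : Finset ℕ) (x : ℕ → ℝ) : ℝ :=
  ∑ S ∈ B.powerset, c #S * ∏ p ∈ S, x p

/-- Coefficients of the product `∏ (1 - x p)` truncated at degree `m`. -/
def altCoeff (m i : ℕ) : ℝ := if i ≤ m then (-1) ^ i else 0

/-- Coefficients of the elementary symmetric function of degree `m`. -/
def deltaCoeff (m i : ℕ) : ℝ := if i = m then 1 else 0

theorem symmPoly_empty (c : ℕ → ℝ) (x : ℕ → ℝ) : symmPoly c ∅ x = c 0 := by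
  simp [symmPoly]

theorem symmPoly_insert (c : ℕ → ℝ) {p : ℕ} {B : Finset ℕ} (hp : p ∉ B) (x : ℕ → ℝ) :
    symmPoly c (insert p B) x =
      symmPoly c B x + x p * symmPoly (fun i => c (i + 1)) B x := by
  unfold symmPoly
  rw [sum_powerset_insert hp, mul_sum]
  congr 1
  refine sum_congr rfl fun S hS => ?_
  have hpS : p ∉ S := fun h => hp (mem_powerset.1 hS h)
  rw [card_insert_of_notMem hpS, prod_insert hpS]
  ring

theorem symmPoly_nonneg {c : ℕ → ℝ} (hc : ∀ i, 0 ≤ c i) {B : Finset ℕ} {x : ℕ → ℝ}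
    (hx : ∀ p ∈ B, 0 ≤ x p) : 0 ≤ symmPoly c B x :=
  sum_nonneg fun _ hS => mul_nonneg (hc _) (prod_nonneg fun p hp => hx p (mem_powerset.1 hS hp))

theorem symmPoly_mono_set {c : ℕ → ℝ} (hc : ∀ i, 0 ≤ c i) {A B : Finset ℕ} {x : ℕ → ℝ}
    (hAB : A ⊆ B) (hx : ∀ p ∈ B, 0 ≤ x p) : symmPoly c A x ≤ symmPoly c B x :=
  sum_le_sum_of_subset_of_nonneg (powerset_mono.2 hAB) fun _ hS _ =>
    mul_nonneg (hc _) (prod_nonneg fun p hp => hx p (mem_powerset.1 hS hp))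

theorem deltaCoeff_nonneg (m i : ℕ) : 0 ≤ deltaCoeff m i := by
  unfold deltaCoeff; split_ifs <;> norm_num

/-- Bonferroni's inequalities, in a form that holds for all values `x p ∈ [0, 1]`, and so both for
indicator functions and for their densities. -/
theorem symmPoly_bonferroni (B : Finset ℕ) (x : ℕ → ℝ) (hx0 : ∀ p ∈ B, 0 ≤ x p)
    (hx1 : ∀ p ∈ B, x p ≤ 1) (m : ℕ) :
    0 ≤ (-1) ^ m * (symmPoly (altCoeff m) B x - ∏ p ∈ B, (1 - x p)) ∧
    (-1) ^ m * (symmPoly (altCoeff m) B x - ∏ p ∈ B, (1 - x p)) ≤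
      symmPoly (deltaCoeff (m + 1)) B x := by
  induction B using Finset.induction generalizing m with
  | empty => simp [symmPoly_empty, altCoeff, deltaCoeff]
  | insert p B hp ih =>
    have hB0 : ∀ q ∈ B, 0 ≤ x q := fun q hq => hx0 q (mem_insert_of_mem hq)
    have hB1 : ∀ q ∈ B, x q ≤ 1 := fun q hq => hx1 q (mem_insert_of_mem hq)
    have hxp0 := hx0 p (mem_insert_self _ _)
    specialize ih hB0 hB1
    rw [symmPoly_insert _ hp, symmPoly_insert _ hp, prod_insert hp]
    have hd : (fun i => deltaCoeff (m + 1) (i + 1)) = deltaCoeff m := by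
      funext i; simp [deltaCoeff]
    rw [hd]
    obtain ⟨h1, h2⟩ := ih m
    cases m with
    | zero =>
      have ha : (fun i => altCoeff 0 (i + 1)) = fun _ => 0 := by
        funext i; simp [altCoeff]
      have hV0 : 0 ≤ ∏ q ∈ B, (1 - x q) := prod_nonneg fun q hq => sub_nonneg.2 (hB1 q hq)
      have hV1 : ∏ q ∈ B, (1 - x q) ≤ 1 :=
        prod_le_one (fun q hq => sub_nonneg.2 (hB1 q hq)) fun q hq => by linarith [hB0 q hq]
      have hz : symmPoly (fun _ => 0) B x = 0 := by simp [symmPoly]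
      have he : symmPoly (deltaCoeff 0) B x = 1 := by
        simp only [symmPoly, deltaCoeff, card_eq_zero, ite_mul, one_mul, zero_mul]
        rw [sum_ite_eq' B.powerset ∅]
        simp
      rw [ha, hz, he]
      simp only [pow_zero, one_mul] at h1 h2 ⊢
      constructor
      · nlinarith
      · nlinarith
    | succ m =>
      have ha : symmPoly (fun i => altCoeff (m + 1) (i + 1)) B x = -symmPoly (altCoeff m) B x := by
        simp only [symmPoly, altCoeff, ← sum_neg_distrib]
        refine sum_congr rfl fun S _ => ?_
        simp only [add_le_add_iff_right]
        split_ifs <;> ring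
      obtain ⟨h3, h4⟩ := ih m
      have key : (-1 : ℝ) ^ (m + 1) * (symmPoly (altCoeff (m + 1)) B x
            + x p * symmPoly (fun i => altCoeff (m + 1) (i + 1)) B x
            - (1 - x p) * ∏ q ∈ B, (1 - x q))
          = (-1) ^ (m + 1) * (symmPoly (altCoeff (m + 1)) B x - ∏ q ∈ B, (1 - x q))
            + x p * ((-1) ^ m * (symmPoly (altCoeff m) B x - ∏ q ∈ B, (1 - x q))) := by
        rw [ha]; ring
      rw [key]
      constructor
      · positivity
      · have := mul_le_mul_of_nonneg_left h4 hxp0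
        linarith

/-- The even case of Bonferroni's inequalities: the truncation is an upper bound. -/
theorem symmPoly_bonferroni_even (B : Finset ℕ) (x : ℕ → ℝ) (hx0 : ∀ p ∈ B, 0 ≤ x p)
    (hx1 : ∀ p ∈ B, x p ≤ 1) (b : ℕ) :
    ∏ p ∈ B, (1 - x p) ≤ symmPoly (altCoeff (2 * b)) B x ∧
    symmPoly (altCoeff (2 * b)) B x ≤
      ∏ p ∈ B, (1 - x p) + symmPoly (deltaCoeff (2 * b + 1)) B x := by
  have := symmPoly_bonferroni B x hx0 hx1 (2 * b)
  rw [(even_two_mul b).neg_one_pow, one_mul] at this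
  constructor <;> linarith [this.1, this.2]

/-- Rankin's trick for elementary symmetric functions of degree at most `m`, for a weight `y ≥ 1`:
there each degree-`i` term is at most `y ^ m` times its value at `x / y`. -/
theorem symmPoly_le_pow_mul_exp {c : ℕ → ℝ} {m : ℕ} (hc1 : ∀ i, c i ≤ 1)
    (hcm : ∀ i, m < i → c i = 0) {B : Finset ℕ} {x : ℕ → ℝ} (hx : ∀ p ∈ B, 0 ≤ x p)
    {y : ℝ} (hy : 1 ≤ y) :
    symmPoly c B x ≤ y ^ m * Real.exp (∑ p ∈ B, x p / y) := by
  have hy0 : 0 < y := by linarith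
  have h1 : ∑ S ∈ B.powerset, ∏ p ∈ S, x p / y ≤ Real.exp (∑ p ∈ B, x p / y) := by
    rw [← prod_one_add, Real.exp_sum]
    refine prod_le_prod (fun p hp => ?_) fun p _ => ?_
    · have := div_nonneg (hx p hp) hy0.le
      linarith
    · linarith [Real.add_one_le_exp (x p / y)]
  refine le_trans ?_ (mul_le_mul_of_nonneg_left h1 (by positivity))
  rw [mul_sum]
  refine sum_le_sum fun S hS => ?_
  have hP : 0 ≤ ∏ p ∈ S, x p := prod_nonneg fun p hp => hx p (mem_powerset.1 hS hp)
  rw [prod_div_distrib, prod_const]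
  rcases le_or_gt #S m with h | h
  · have h2 : c #S * ∏ p ∈ S, x p ≤ ∏ p ∈ S, x p := by nlinarith [hc1 #S]
    refine h2.trans ?_
    rw [mul_div_assoc', le_div_iff₀ (by positivity), mul_comm]
    exact mul_le_mul_of_nonneg_right (pow_le_pow_right₀ hy h) hP
  · rw [hcm _ h, zero_mul]
    positivity

/-- Rankin's trick for the elementary symmetric function of degree `m`, with weight `2`. -/
theorem symmPoly_delta_le (m : ℕ) {B : Finset ℕ} {x : ℕ → ℝ} (hx : ∀ p ∈ B, 0 ≤ x p) :
    symmPoly (deltaCoeff m) B x ≤ (1 / 2) ^ m * Real.exp (2 * ∑ p ∈ B, x p) := by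
  have h1 : ∑ S ∈ B.powerset, ∏ p ∈ S, (2 * x p) ≤ Real.exp (2 * ∑ p ∈ B, x p) := by
    rw [← prod_one_add, mul_sum, Real.exp_sum]
    refine prod_le_prod (fun p hp => ?_) fun p _ => ?_
    · linarith [hx p hp]
    · linarith [Real.add_one_le_exp (2 * x p)]
  refine le_trans ?_ (mul_le_mul_of_nonneg_left h1 (by positivity))
  rw [mul_sum]
  refine sum_le_sum fun S hS => ?_
  have hP : 0 ≤ ∏ p ∈ S, x p := prod_nonneg fun p hp => hx p (mem_powerset.1 hS hp)
  rw [prod_mul_distrib, prod_const, deltaCoeff]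
  split_ifs with h
  · rw [h, ← mul_assoc, ← mul_pow]
    norm_num
  · rw [zero_mul]
    positivity

/-- The first-order inequality that turns truncated upper bounds into a lower bound. -/
theorem prod_sub_sum_le_prod {ι : Type*} [DecidableEq ι] (s : Finset ι) (u v e : ι → ℝ)
    (hv : ∀ i ∈ s, 0 ≤ v i) (hvu : ∀ i ∈ s, v i ≤ u i) (hue : ∀ i ∈ s, u i ≤ v i + e i) :
    ∏ i ∈ s, u i - ∑ i ∈ s, e i * ∏ j ∈ s.erase i, u j ≤ ∏ i ∈ s, v i := by
  induction s using Finset.induction with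
  | empty => simp
  | insert a s ha ih =>
    have hv' := fun i hi => hv i (mem_insert_of_mem hi)
    have hvu' := fun i hi => hvu i (mem_insert_of_mem hi)
    specialize ih hv' hvu' fun i hi => hue i (mem_insert_of_mem hi)
    have h1 : ∑ i ∈ s, e i * ∏ j ∈ (insert a s).erase i, u j
        = u a * ∑ i ∈ s, e i * ∏ j ∈ s.erase i, u j := by
      rw [mul_sum]
      refine sum_congr rfl fun i hi => ?_
      have hia : a ≠ i := fun h => ha (h ▸ hi)
      rw [erase_insert_of_ne hia, prod_insert (fun h => ha (mem_of_mem_erase h))]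
      ring
    rw [prod_insert ha, prod_insert ha, sum_insert ha, erase_insert ha, h1]
    have hva := hv a (mem_insert_self _ _)
    have hvua := hvu a (mem_insert_self _ _)
    have huea := hue a (mem_insert_self _ _)
    have hpu : ∏ i ∈ s, v i ≤ ∏ i ∈ s, u i := prod_le_prod hv' hvu'
    have hpv : 0 ≤ ∏ i ∈ s, v i := prod_nonneg hv'
    -- `∏ u - ∏ v = u a (∏ u' - ∏ v') + (u a - v a) ∏ v'`, with `∏ v' ≤ ∏ u'`
    have h2 := mul_le_mul_of_nonneg_left ih (hva.trans hvua)
    have h3 : (u a - v a) * ∏ i ∈ s, v i ≤ e a * ∏ i ∈ s, u i := by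
      refine mul_le_mul (by linarith) hpu hpv (by linarith)
    nlinarith

/-! ### Sums of periodic functions -/

theorem sum_range_mul_add_of_periodic {w : ℕ → ℝ} {d : ℕ} (hw : Function.Periodic w d)
    (a b : ℕ) : ∑ n ∈ range (d * a + b), w n = a * ∑ n ∈ range d, w n + ∑ n ∈ range b, w n := by
  induction a with
  | zero => simp
  | succ a ih =>
    have h1 : d * (a + 1) + b = d + (d * a + b) := by ring
    have h2 : ∀ n, w (d + n) = w n := fun n => by rw [add_comm]; exact hw n
    rw [h1, sum_range_add]
    simp only [h2]
    rw [ih]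
    push_cast
    ring

theorem abs_sum_range_sub_le_of_periodic {w : ℕ → ℝ} {d : ℕ} (hd : 0 < d)
    (hw : Function.Periodic w d) (hw0 : ∀ n, 0 ≤ w n) (N : ℕ) :
    |∑ n ∈ range N, w n - (∑ n ∈ range d, w n) * N / d| ≤ ∑ n ∈ range d, w n := by
  have hd' : (0 : ℝ) < d := by exact_mod_cast hd
  have h := sum_range_mul_add_of_periodic hw (N / d) (N % d)
  rw [Nat.div_add_mod] at h
  set c := ∑ n ∈ range d, w n
  have hc : 0 ≤ c := sum_nonneg fun n _ => hw0 n
  have hr0 : 0 ≤ ∑ n ∈ range (N % d), w n := sum_nonneg fun n _ => hw0 n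
  have hr1 : ∑ n ∈ range (N % d), w n ≤ c :=
    sum_le_sum_of_subset_of_nonneg (range_mono (Nat.mod_lt _ hd).le) fun n _ _ => hw0 n
  have h1 : ((N / d : ℕ) : ℝ) ≤ N / d := Nat.cast_div_le
  have h2 : (N : ℝ) / d ≤ ((N / d : ℕ) : ℝ) + 1 := by
    rw [div_le_iff₀ hd']
    have := Nat.lt_mul_div_succ N hd
    have h3 : (N : ℝ) ≤ d * ((N / d : ℕ) + 1) := by exact_mod_cast this.le
    linarith
  rw [h, abs_le, mul_div_assoc]
  constructor <;> nlinarith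

/-- The Chinese remainder theorem for sums over a full period. -/
theorem sum_range_mul_of_periodic {f g : ℕ → ℝ} {a b : ℕ} (hab : a.Coprime b) (ha : 0 < a)
    (hb : 0 < b) (hf : Function.Periodic f a) (hg : Function.Periodic g b) :
    ∑ n ∈ range (a * b), f n * g n = (∑ n ∈ range a, f n) * ∑ n ∈ range b, g n := by
  rw [sum_mul_sum, ← sum_product']
  refine sum_bij (fun n _ => (n % a, n % b)) (fun n _ => ?_) (fun m hm n hn h => ?_)
    (fun q hq => ?_) fun n _ => ?_
  · simp [Nat.mod_lt, ha, hb]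
  · simp only [Prod.mk.injEq] at h
    have h1 : m ≡ n [MOD a * b] := (Nat.modEq_and_modEq_iff_modEq_mul hab).1 h
    exact h1.eq_of_lt_of_lt (mem_range.1 hm) (mem_range.1 hn)
  · simp only [mem_product, mem_range] at hq
    refine ⟨Nat.chineseRemainder hab q.1 q.2, ?_, ?_⟩
    · exact mem_range.2 (Nat.chineseRemainder_lt_mul hab _ _ ha.ne' hb.ne')
    · have := (Nat.chineseRemainder hab q.1 q.2).2
      ext
      · exact Eq.trans this.1 (Nat.mod_eq_of_lt hq.1)
      · exact Eq.trans this.2 (Nat.mod_eq_of_lt hq.2)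
  · simp only [hf.map_mod_nat, hg.map_mod_nat]

theorem sum_range_prod_of_periodic {w : ℕ → ℝ} {d : ℕ} (hd : 0 < d) (hw : Function.Periodic w d)
    (x : ℕ → ℕ → ℝ) (S : Finset ℕ) (hS : ∀ p ∈ S, p.Prime) (hdS : ∀ p ∈ S, d.Coprime p)
    (hx : ∀ p ∈ S, Function.Periodic (x p) p) :
    Function.Periodic (fun n => w n * ∏ p ∈ S, x p n) (d * ∏ p ∈ S, p) ∧
    ∑ n ∈ range (d * ∏ p ∈ S, p), w n * ∏ p ∈ S, x p n =
      (∑ n ∈ range d, w n) * ∏ p ∈ S, ∑ n ∈ range p, x p n := by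
  induction S using Finset.induction with
  | empty => simpa using hw
  | insert q S hq ih =>
    obtain ⟨ih1, ih2⟩ := ih (fun p hp => hS p (mem_insert_of_mem hp))
      (fun p hp => hdS p (mem_insert_of_mem hp)) (fun p hp => hx p (mem_insert_of_mem hp))
    have hxq := hx q (mem_insert_self _ _)
    have hqp := hS q (mem_insert_self _ _)
    have hmod : d * ∏ p ∈ insert q S, p = d * (∏ p ∈ S, p) * q := by
      rw [prod_insert hq]; ring
    have hfun : (fun n => w n * ∏ p ∈ insert q S, x p n) =
        fun n => (w n * ∏ p ∈ S, x p n) * x q n := by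
      funext n; rw [prod_insert hq]; ring
    have hcop : (d * ∏ p ∈ S, p).Coprime q := by
      refine Nat.Coprime.mul_left (hdS q (mem_insert_self _ _)) ?_
      refine Nat.Coprime.prod_left fun p hp => ?_
      exact (Nat.coprime_primes (hS p (mem_insert_of_mem hp)) hqp).2 fun h => hq (h ▸ hp)
    have hpos : 0 < d * ∏ p ∈ S, p :=
      Nat.mul_pos hd (prod_pos fun p hp => (hS p (mem_insert_of_mem hp)).pos)
    constructor
    · rw [hfun, hmod]
      intro n
      have e1 := ih1.nsmul q n
      have e2 := hxq.nsmul (d * ∏ p ∈ S, p) n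
      simp only [smul_eq_mul] at e1 e2
      rw [mul_comm q] at e1
      simp only [e1, e2]
    · have := sum_range_mul_of_periodic hcop hpos hqp.pos ih1 hxq
      rw [hmod, prod_insert hq]
      have h2 : ∀ n, w n * ∏ p ∈ insert q S, x p n = (w n * ∏ p ∈ S, x p n) * x q n :=
        fun n => congrFun hfun n
      simp only [h2]
      rw [this, ih2]
      ring

/-- The mean value of a product over disjoint blocks of primes `B j` of polynomials in
functions `x p` of period `p`, against a weight `w` of period `d`: the main term is the same
product with every `x p` replaced by its mean value. -/
theorem abs_sum_prod_symmPoly_sub_le (x : ℕ → ℕ → ℝ) (hx0 : ∀ p n, 0 ≤ x p n) (N : ℕ)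
    (ι : Finset ℕ) (B : ℕ → Finset ℕ) (c : ℕ → ℕ → ℝ)
    (hB : ∀ j ∈ ι, ∀ p ∈ B j, p.Prime)
    (hdisj : (ι : Set ℕ).PairwiseDisjoint B)
    (hx : ∀ j ∈ ι, ∀ p ∈ B j, Function.Periodic (x p) p)
    {w : ℕ → ℝ} {d : ℕ} (hd : 0 < d) (hw : Function.Periodic w d) (hw0 : ∀ n, 0 ≤ w n)
    (hdB : ∀ j ∈ ι, ∀ p ∈ B j, d.Coprime p) :
    |∑ n ∈ range N, w n * ∏ j ∈ ι, symmPoly (c j) (B j) (fun p => x p n) -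
      (∑ n ∈ range d, w n) * N / d *
        ∏ j ∈ ι, symmPoly (c j) (B j) (fun p => (∑ n ∈ range p, x p n) / p)| ≤
    (∑ n ∈ range d, w n) *
      ∏ j ∈ ι, symmPoly (fun i => |c j i|) (B j) (fun p => ∑ n ∈ range p, x p n) := by
  induction ι using Finset.induction generalizing w d with
  | empty => simpa using abs_sum_range_sub_le_of_periodic hd hw hw0 N
  | insert a ι ha ih =>
    have hB' := fun j hj => hB j (mem_insert_of_mem hj)
    have hx' := fun j hj => hx j (mem_insert_of_mem hj)
    have hBa := hB a (mem_insert_self _ _)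
    have hxa := hx a (mem_insert_self _ _)
    have hda := hdB a (mem_insert_self _ _)
    have hdisj' : (ι : Set ℕ).PairwiseDisjoint B :=
      hdisj.subset (by simp)
    have hwS := fun S (hS : S ⊆ B a) => sum_range_prod_of_periodic hd hw x S
      (fun p hp => hBa p (hS hp)) (fun p hp => hda p (hS hp)) (fun p hp => hxa p (hS hp))
    have key : ∀ S ⊆ B a,
        |∑ n ∈ range N, (w n * ∏ p ∈ S, x p n) * ∏ j ∈ ι, symmPoly (c j) (B j) (fun p => x p n) -
          (∑ n ∈ range d, w n) * (∏ p ∈ S, (∑ n ∈ range p, x p n) / p) * N / d *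
            ∏ j ∈ ι, symmPoly (c j) (B j) (fun p => (∑ n ∈ range p, x p n) / p)| ≤
        (∑ n ∈ range d, w n) * (∏ p ∈ S, ∑ n ∈ range p, x p n) *
          ∏ j ∈ ι, symmPoly (fun i => |c j i|) (B j) (fun p => ∑ n ∈ range p, x p n) := by
      intro S hS
      have hpos : 0 < d * ∏ p ∈ S, p := Nat.mul_pos hd (prod_pos fun p hp => (hBa p (hS hp)).pos)
      have h := ih hB' hdisj' hx' hpos (hwS S hS).1
        (fun n => mul_nonneg (hw0 n) (prod_nonneg fun p _ => hx0 p n))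
        (fun j hj p hp => by
          refine Nat.Coprime.mul_left (hdB j (mem_insert_of_mem hj) p hp) ?_
          refine Nat.Coprime.prod_left fun q hq => ?_
          refine (Nat.coprime_primes (hBa q (hS hq)) (hB' j hj p hp)).2 fun hqp => ?_
          have hne : a ≠ j := fun h => ha (h ▸ hj)
          exact disjoint_left.1 (hdisj (by simp) (by simp [hj]) hne) (hS hq) (hqp ▸ hp))
      rw [(hwS S hS).2] at h
      convert h using 4
      have hd' : (d : ℝ) ≠ 0 := by exact_mod_cast hd.ne'
      have hp' : (∏ p ∈ S, (p : ℝ)) ≠ 0 :=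
        prod_ne_zero_iff.2 fun p hp => by exact_mod_cast (hBa p (hS hp)).ne_zero
      rw [prod_div_distrib]
      push_cast
      field_simp
    have e1 : ∑ n ∈ range N, w n * ∏ j ∈ insert a ι, symmPoly (c j) (B j) (fun p => x p n) =
        ∑ S ∈ (B a).powerset, c a #S * ∑ n ∈ range N,
          (w n * ∏ p ∈ S, x p n) * ∏ j ∈ ι, symmPoly (c j) (B j) (fun p => x p n) := by
      simp only [mul_sum]
      rw [sum_comm]
      refine sum_congr rfl fun n _ => ?_
      rw [prod_insert ha, symmPoly, sum_mul, mul_sum]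
      exact sum_congr rfl fun S _ => by ring
    have e2 : (∑ n ∈ range d, w n) * N / d * ∏ j ∈ insert a ι,
          symmPoly (c j) (B j) (fun p => (∑ n ∈ range p, x p n) / p) =
        ∑ S ∈ (B a).powerset, c a #S * ((∑ n ∈ range d, w n) *
          (∏ p ∈ S, (∑ n ∈ range p, x p n) / p) * N / d *
            ∏ j ∈ ι, symmPoly (c j) (B j) (fun p => (∑ n ∈ range p, x p n) / p)) := by
      rw [prod_insert ha]
      generalize ∑ n ∈ range d, w n = W
      conv_lhs => rw [symmPoly, sum_mul, mul_sum]
      exact sum_congr rfl fun S _ => by ring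
    have e3 : (∑ n ∈ range d, w n) * ∏ j ∈ insert a ι,
          symmPoly (fun i => |c j i|) (B j) (fun p => ∑ n ∈ range p, x p n) =
        ∑ S ∈ (B a).powerset, |c a #S| * ((∑ n ∈ range d, w n) *
          (∏ p ∈ S, ∑ n ∈ range p, x p n) *
            ∏ j ∈ ι, symmPoly (fun i => |c j i|) (B j) (fun p => ∑ n ∈ range p, x p n)) := by
      rw [prod_insert ha]
      generalize ∑ n ∈ range d, w n = W
      conv_lhs => rw [symmPoly, sum_mul, mul_sum]
      exact sum_congr rfl fun S _ => by ring
    rw [e1, e2, e3, ← sum_sub_distrib]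
    refine (abs_sum_le_sum_abs _ _).trans (sum_le_sum fun S hS => ?_)
    rw [← mul_sub, abs_mul]
    exact mul_le_mul_of_nonneg_left (key S (mem_powerset.1 hS)) (abs_nonneg _)

/-! ### The Brun–Hooley sieve -/

/-- The mean value over a period of a function `x p` of period `p`. -/
noncomputable def density (x : ℕ → ℕ → ℝ) (p : ℕ) : ℝ := (∑ n ∈ range p, x p n) / p

/-- A sieve problem for the blocks of primes `B j`, `j ∈ ι`: the function `x p`, of period `p`,
indicates the residue classes modulo `p` to be avoided. `Y j` bounds the primes of the block,
`L j` its sieving density, and `2 * b j` is the degree at which the inclusion-exclusion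
for this block is truncated; `tail` says that the truncation loses little. -/
structure IsBlockSieve (x : ℕ → ℕ → ℝ) (ι : Finset ℕ) (B : ℕ → Finset ℕ) (b : ℕ → ℕ)
    (Y L : ℕ → ℝ) : Prop where
  nonneg : ∀ p n, 0 ≤ x p n
  le_one : ∀ p n, x p n ≤ 1
  prime : ∀ j ∈ ι, ∀ p ∈ B j, p.Prime
  disjoint : (ι : Set ℕ).PairwiseDisjoint B
  periodic : ∀ j ∈ ι, ∀ p ∈ B j, Function.Periodic (x p) p
  density_le : ∀ j ∈ ι, ∀ p ∈ B j, density x p ≤ 1 / 8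
  sum_density_le : ∀ j ∈ ι, ∑ p ∈ B j, density x p ≤ L j
  le_Y : ∀ j ∈ ι, ∀ p ∈ B j, (p : ℝ) ≤ Y j
  one_le_Y : ∀ j ∈ ι, 1 ≤ Y j
  tail : ∑ j ∈ ι, (1 / 2) ^ (2 * b j + 1) * Real.exp (4 * L j) ≤ 1 / 2

namespace IsBlockSieve

variable {x : ℕ → ℕ → ℝ} {ι : Finset ℕ} {B : ℕ → Finset ℕ} {b : ℕ → ℕ} {Y L : ℕ → ℝ}

theorem density_nonneg (h : IsBlockSieve x ι B b Y L) (p : ℕ) : 0 ≤ density x p :=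
  div_nonneg (sum_nonneg fun n _ => h.nonneg p n) (Nat.cast_nonneg p)

theorem prod_one_sub_density_pos (h : IsBlockSieve x ι B b Y L) {j : ℕ} (hj : j ∈ ι)
    {A : Finset ℕ} (hA : A ⊆ B j) : 0 < ∏ p ∈ A, (1 - density x p) :=
  prod_pos fun p hp => by linarith [h.density_le j hj p (hA hp)]

theorem exp_le_prod_one_sub_density (h : IsBlockSieve x ι B b Y L) {j : ℕ} (hj : j ∈ ι) :
    Real.exp (-(2 * L j)) ≤ ∏ p ∈ B j, (1 - density x p) := by
  calc Real.exp (-(2 * L j)) ≤ Real.exp (∑ p ∈ B j, -(2 * density x p)) := by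
        refine Real.exp_le_exp.2 ?_
        rw [sum_neg_distrib, ← mul_sum]
        linarith [h.sum_density_le j hj]
    _ = ∏ p ∈ B j, Real.exp (-(2 * density x p)) := Real.exp_sum _ _
    _ ≤ _ := by
        refine prod_le_prod (fun p _ => (Real.exp_pos _).le) fun p hp => ?_
        have h0 := h.density_nonneg p
        have h1 := h.density_le j hj p hp
        have h2 := Real.add_one_le_exp (2 * density x p)
        rw [Real.exp_neg, inv_le_iff_one_le_mul₀ (Real.exp_pos _)]
        nlinarith

theorem symmPoly_delta_density_le (h : IsBlockSieve x ι B b Y L) {j : ℕ} (hj : j ∈ ι) :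
    symmPoly (deltaCoeff (2 * b j + 1)) (B j) (density x) ≤
      (1 / 2) ^ (2 * b j + 1) * Real.exp (4 * L j) * ∏ p ∈ B j, (1 - density x p) := by
  refine (symmPoly_delta_le _ fun p _ => h.density_nonneg p).trans ?_
  rw [mul_assoc]
  refine mul_le_mul_of_nonneg_left ?_ (by positivity)
  calc Real.exp (2 * ∑ p ∈ B j, density x p) ≤ Real.exp (2 * L j) :=
        Real.exp_le_exp.2 (by linarith [h.sum_density_le j hj])
    _ = Real.exp (4 * L j) * Real.exp (-(2 * L j)) := by rw [← Real.exp_add]; ring_nf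
    _ ≤ _ := mul_le_mul_of_nonneg_left (h.exp_le_prod_one_sub_density hj) (Real.exp_pos _).le

/-- The error terms of the sieve, uniformly over coefficients bounded by `1` and over subsets of the
blocks. -/
theorem prod_symmPoly_abs_le (h : IsBlockSieve x ι B b Y L) (A : ℕ → Finset ℕ)
    (hA : ∀ j ∈ ι, A j ⊆ B j) (c : ℕ → ℕ → ℝ) (hc : ∀ j i, |c j i| ≤ 1)
    (hc0 : ∀ j i, 2 * b j + 1 < i → c j i = 0) :
    ∏ j ∈ ι, symmPoly (fun i => |c j i|) (A j) (fun p => ∑ n ∈ range p, x p n) ≤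
      ∏ j ∈ ι, Y j ^ (2 * b j + 1) * Real.exp (L j) := by
  have hρ : ∀ p, 0 ≤ ∑ n ∈ range p, x p n := fun p => sum_nonneg fun n _ => h.nonneg p n
  refine prod_le_prod (fun j _ => symmPoly_nonneg (fun i => abs_nonneg _) fun p _ => hρ p)
    fun j hj => ?_
  have hY := h.one_le_Y j hj
  refine (symmPoly_le_pow_mul_exp (m := 2 * b j + 1) (hc j) (fun i hi => by simp [hc0 j i hi])
    (fun p _ => hρ p) hY).trans ?_
  refine mul_le_mul_of_nonneg_left (Real.exp_le_exp.2 ?_) (pow_nonneg (by linarith) _)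
  refine le_trans ?_ (h.sum_density_le j hj)
  refine le_trans (sum_le_sum_of_subset_of_nonneg (hA j hj) fun p _ _ =>
    div_nonneg (hρ p) (by linarith)) (sum_le_sum fun p hp => ?_)
  have : (0 : ℝ) < p := by exact_mod_cast (h.prime j hj p hp).pos
  exact div_le_div_of_nonneg_left (hρ p) this (h.le_Y j hj p hp)

theorem abs_altCoeff_le (m i : ℕ) : |altCoeff m i| ≤ 1 := by
  unfold altCoeff; split_ifs <;> simp

theorem abs_deltaCoeff_le (m i : ℕ) : |deltaCoeff m i| ≤ 1 := by
  unfold deltaCoeff; split_ifs <;> simp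

/-- The upper bound sieve, for `n` weighted by a function of period `d`. Primes that divide `d`
are not sieved by, at the cost of the factor `(8 / 7) ^ Ω(d)`. -/
theorem sum_weighted_prod_le (h : IsBlockSieve x ι B b Y L) (N : ℕ) {w : ℕ → ℝ} {d : ℕ}
    (hd : 0 < d) (hw : Function.Periodic w d) (hw0 : ∀ n, 0 ≤ w n)
    (hw1 : ∑ n ∈ range d, w n = 1) :
    ∑ n ∈ range N, w n * ∏ j ∈ ι, ∏ p ∈ B j, (1 - x p n) ≤
      2 * (N / d) * (8 / 7) ^ (ArithmeticFunction.cardFactors d) *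
          ∏ j ∈ ι, ∏ p ∈ B j, (1 - density x p) +
        ∏ j ∈ ι, Y j ^ (2 * b j + 1) * Real.exp (L j) := by
  set A : ℕ → Finset ℕ := fun j => (B j).filter (fun p => ¬ p ∣ d) with hAdef
  have hA : ∀ j ∈ ι, A j ⊆ B j := fun j _ => filter_subset _ _
  have hmean := abs_sum_prod_symmPoly_sub_le x h.nonneg N ι A (fun j => altCoeff (2 * b j))
    (fun j hj p hp => h.prime j hj p (hA j hj hp))
    (fun i hi j hj hij => (h.disjoint hi hj hij).mono (hA i hi) (hA j hj))
    (fun j hj p hp => h.periodic j hj p (hA j hj hp)) hd hw hw0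
    (fun j hj p hp => by
      rw [Nat.coprime_comm, (h.prime j hj p (hA j hj hp)).coprime_iff_not_dvd]
      exact (mem_filter.1 hp).2)
  rw [hw1, one_mul, one_mul] at hmean
  have herr := h.prod_symmPoly_abs_le A hA (fun j => altCoeff (2 * b j))
    (fun j i => abs_altCoeff_le _ _) (fun j i hi => by simp [altCoeff]; omega)
  have hbon := fun j (hj : j ∈ ι) => symmPoly_bonferroni_even (A j) (density x)
    (fun p _ => h.density_nonneg p)
    (fun p hp => by linarith [h.density_le j hj p (hA j hj hp)]) (b j)
  have h1 : ∑ n ∈ range N, w n * ∏ j ∈ ι, ∏ p ∈ B j, (1 - x p n) ≤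
      ∑ n ∈ range N, w n * ∏ j ∈ ι, symmPoly (altCoeff (2 * b j)) (A j) (fun p => x p n) := by
    refine sum_le_sum fun n _ => mul_le_mul_of_nonneg_left ?_ (hw0 n)
    refine prod_le_prod (fun j _ => prod_nonneg fun p _ => by linarith [h.le_one p n])
      fun j hj => ?_
    refine le_trans ?_ (symmPoly_bonferroni_even (A j) (fun p => x p n)
      (fun p _ => h.nonneg p n) (fun p _ => h.le_one p n) (b j)).1
    rw [← prod_filter_mul_prod_filter_not (B j) (fun p => ¬ p ∣ d)]
    refine mul_le_of_le_one_right (prod_nonneg fun p _ => by linarith [h.le_one p n]) ?_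
    exact prod_le_one (fun p _ => by linarith [h.le_one p n]) fun p _ => by linarith [h.nonneg p n]
  set η : ℕ → ℝ := fun j => (1 / 2) ^ (2 * b j + 1) * Real.exp (4 * L j) with hη
  have hη0 : ∀ j, 0 ≤ η j := fun j => by positivity
  -- each block contributes at most `exp (η j)` times the sieve product over all of `B j`, and a
  -- factor `8 / 7` for each prime left out
  have h2 : ∀ j ∈ ι, symmPoly (altCoeff (2 * b j)) (A j) (density x) ≤
      Real.exp (η j) * ((8 / 7) ^ #((B j).filter (fun p => p ∣ d)) *
        ∏ p ∈ B j, (1 - density x p)) := by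
    intro j hj
    have hVA := h.prod_one_sub_density_pos hj (hA j hj)
    have hV : ∏ p ∈ B j, (1 - density x p) ≤ ∏ p ∈ A j, (1 - density x p) := by
      rw [← prod_filter_mul_prod_filter_not (B j) (fun p => ¬ p ∣ d)]
      refine mul_le_of_le_one_right hVA.le (prod_le_one (fun p hp => ?_) fun p _ => ?_)
      · linarith [h.density_le j hj p (mem_filter.1 hp).1]
      · linarith [h.density_nonneg p]
    have hV2 : ∏ p ∈ A j, (1 - density x p) ≤ (8 / 7) ^ #((B j).filter (fun p => p ∣ d)) *
        ∏ p ∈ B j, (1 - density x p) := by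
      rw [← prod_filter_mul_prod_filter_not (B j) (fun p => p ∣ d), ← mul_assoc, ← prod_const,
        ← prod_mul_distrib]
      refine le_mul_of_one_le_left hVA.le (one_le_prod fun p hp => ?_)
      linarith [h.density_le j hj p (mem_filter.1 hp).1]
    have hδ : symmPoly (deltaCoeff (2 * b j + 1)) (A j) (density x) ≤
        η j * ∏ p ∈ A j, (1 - density x p) :=
      (symmPoly_mono_set (deltaCoeff_nonneg _) (hA j hj) fun p _ => h.density_nonneg p).trans
        ((h.symmPoly_delta_density_le hj).trans (mul_le_mul_of_nonneg_left hV (hη0 j)))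
    calc _ ≤ (η j + 1) * ∏ p ∈ A j, (1 - density x p) := by linarith [(hbon j hj).2]
      _ ≤ _ := mul_le_mul (Real.add_one_le_exp _) hV2 hVA.le (Real.exp_pos _).le
  have h3 : ∏ j ∈ ι, symmPoly (altCoeff (2 * b j)) (A j) (density x) ≤
      2 * ((8 / 7) ^ (ArithmeticFunction.cardFactors d) *
        ∏ j ∈ ι, ∏ p ∈ B j, (1 - density x p)) := by
    have hVpos : 0 < ∏ j ∈ ι, ∏ p ∈ B j, (1 - density x p) :=
      prod_pos fun j hj => h.prod_one_sub_density_pos hj subset_rfl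
    refine (prod_le_prod (fun j hj => ?_) h2).trans ?_
    · exact (h.prod_one_sub_density_pos hj (hA j hj)).le.trans (hbon j hj).1
    rw [prod_mul_distrib, prod_mul_distrib, ← Real.exp_sum, prod_pow_eq_pow_sum]
    refine mul_le_mul ?_ (mul_le_mul_of_nonneg_right ?_ hVpos.le) (by positivity) (by norm_num)
    · calc Real.exp (∑ j ∈ ι, η j) ≤ Real.exp (1 / 2) := Real.exp_le_exp.2 h.tail
        _ ≤ 2 := by
          have := Real.exp_one_lt_d9
          have h4 : Real.exp (1 / 2) * Real.exp (1 / 2) = Real.exp 1 := by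
            rw [← Real.exp_add]; norm_num
          nlinarith [Real.exp_pos (1 / 2)]
    · refine pow_le_pow_right₀ (by norm_num) ?_
      rw [← card_biUnion (fun i hi j hj hij => (h.disjoint hi hj hij).mono (filter_subset _ _)
        (filter_subset _ _))]
      refine le_trans (card_le_card (t := d.primeFactors) fun p hp => ?_) ?_
      · obtain ⟨j, hj, hp⟩ := mem_biUnion.1 hp
        rw [mem_filter] at hp
        exact Nat.mem_primeFactors.2 ⟨h.prime j hj p hp.1, hp.2, hd.ne'⟩
      · exact cardDistinctFactors_le_cardFactors d
  have h4 := (abs_le.1 hmean).2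
  have hNd : (0 : ℝ) ≤ N / d := by positivity
  have h5 := mul_le_mul_of_nonneg_left h3 hNd
  change _ - (N : ℝ) / d * ∏ j ∈ ι, symmPoly (altCoeff (2 * b j)) (A j) (density x) ≤ _ at h4
  calc _ ≤ _ := h1
    _ ≤ (N : ℝ) / d * ∏ j ∈ ι, symmPoly (altCoeff (2 * b j)) (A j) (density x) +
        ∏ j ∈ ι, Y j ^ (2 * b j + 1) * Real.exp (L j) := by linarith
    _ ≤ _ := by linarith

/-- The lower bound sieve. -/
theorem le_sum_prod (h : IsBlockSieve x ι B b Y L) (N : ℕ) :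
    N / 2 * ∏ j ∈ ι, ∏ p ∈ B j, (1 - density x p) -
        (1 + #ι) * ∏ j ∈ ι, Y j ^ (2 * b j + 1) * Real.exp (L j) ≤
      ∑ n ∈ range N, ∏ j ∈ ι, ∏ p ∈ B j, (1 - x p n) := by
  set E := ∏ j ∈ ι, Y j ^ (2 * b j + 1) * Real.exp (L j)
  have hmean : ∀ c : ℕ → ℕ → ℝ, (∀ j i, |c j i| ≤ 1) → (∀ j i, 2 * b j + 1 < i → c j i = 0) →
      |∑ n ∈ range N, ∏ j ∈ ι, symmPoly (c j) (B j) (fun p => x p n) -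
        N * ∏ j ∈ ι, symmPoly (c j) (B j) (density x)| ≤ E := by
    intro c hc hc0
    have := abs_sum_prod_symmPoly_sub_le x h.nonneg N ι B c h.prime h.disjoint h.periodic
      (w := fun _ => 1) (d := 1) one_pos (fun _ => rfl) (fun _ => zero_le_one)
      (fun j _ p _ => Nat.coprime_one_left p)
    simp only [range_one, sum_const, card_singleton, one_smul, one_mul, Nat.cast_one,
      div_one] at this
    exact this.trans (h.prod_symmPoly_abs_le B (fun _ _ => subset_rfl) c hc hc0)
  set η : ℕ → ℝ := fun j => (1 / 2) ^ (2 * b j + 1) * Real.exp (4 * L j) with hη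
  have hη0 : ∀ j, 0 ≤ η j := fun j => by positivity
  set u : ℕ → (ℕ → ℝ) → ℝ := fun j y => symmPoly (altCoeff (2 * b j)) (B j) y
  set e : ℕ → (ℕ → ℝ) → ℝ := fun j y => symmPoly (deltaCoeff (2 * b j + 1)) (B j) y
  have hbon := fun j (hj : j ∈ ι) => symmPoly_bonferroni_even (B j) (density x)
    (fun p _ => h.density_nonneg p)
    (fun p hp => by linarith [h.density_le j hj p hp]) (b j)
  have hV := fun j (hj : j ∈ ι) => h.prod_one_sub_density_pos hj subset_rfl
  have hU : ∀ j ∈ ι, 0 < u j (density x) := fun j hj => (hV j hj).trans_le (hbon j hj).1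
  have hmain : N * ∏ j ∈ ι, u j (density x) - E ≤
      ∑ n ∈ range N, ∏ j ∈ ι, u j (fun p => x p n) := by
    have := (abs_le.1 (hmean (fun j => altCoeff (2 * b j)) (fun j i => abs_altCoeff_le _ _)
      (fun j i hi => by simp [altCoeff]; omega))).1
    simp only [u]
    linarith
  have hloss : ∀ i ∈ ι, ∑ n ∈ range N, e i (fun p => x p n) *
        ∏ j ∈ ι.erase i, u j (fun p => x p n) ≤
      N * (η i * ∏ j ∈ ι, u j (density x)) + E := by
    intro i hi
    let c : ℕ → ℕ → ℝ := fun j =>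
      if j = i then deltaCoeff (2 * b j + 1) else altCoeff (2 * b j)
    have hc : ∀ y : ℕ → ℝ, ∏ j ∈ ι, symmPoly (c j) (B j) y =
        e i y * ∏ j ∈ ι.erase i, u j y := by
      intro y
      rw [← mul_prod_erase ι _ hi]
      congr 1
      · simp [c, e]
      · refine prod_congr rfl fun j hj => ?_
        simp [c, u, ne_of_mem_erase hj]
    have h1 := (abs_le.1 (hmean c
      (fun j i => by
        simp only [c]; split_ifs
        exacts [abs_deltaCoeff_le _ _, abs_altCoeff_le _ _])
      (fun j i hi => by
        simp only [c]; split_ifs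
        · simp [deltaCoeff]; omega
        · simp [altCoeff]; omega))).2
    simp only [hc] at h1
    have h2 : e i (density x) * ∏ j ∈ ι.erase i, u j (density x) ≤
        η i * ∏ j ∈ ι, u j (density x) := by
      rw [← mul_prod_erase ι _ hi, ← mul_assoc]
      refine mul_le_mul_of_nonneg_right ?_
        (prod_nonneg fun j hj => (hU j (mem_of_mem_erase hj)).le)
      exact (h.symmPoly_delta_density_le hi).trans
        (mul_le_mul_of_nonneg_left (hbon i hi).1 (hη0 i))
    have h3 := mul_le_mul_of_nonneg_left h2 (Nat.cast_nonneg (α := ℝ) N)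
    linarith
  have hpt : ∀ n ∈ range N, ∏ j ∈ ι, u j (fun p => x p n) - ∑ i ∈ ι, e i (fun p => x p n) *
      ∏ j ∈ ι.erase i, u j (fun p => x p n) ≤ ∏ j ∈ ι, ∏ p ∈ B j, (1 - x p n) := by
    intro n _
    have hb := fun j => symmPoly_bonferroni_even (B j) (fun p => x p n)
      (fun p _ => h.nonneg p n) (fun p _ => h.le_one p n) (b j)
    exact prod_sub_sum_le_prod ι (fun j => u j (fun p => x p n)) _ (fun j => e j (fun p => x p n))
      (fun j _ => prod_nonneg fun p _ => by linarith [h.le_one p n])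
      (fun j _ => (hb j).1) (fun j _ => (hb j).2)
  refine le_trans ?_ (sum_le_sum hpt)
  rw [sum_sub_distrib, sum_comm]
  have h1 := sum_le_sum hloss
  rw [sum_add_distrib, ← mul_sum, ← sum_mul, sum_const, nsmul_eq_mul] at h1
  have hUpos : 0 ≤ ∏ j ∈ ι, u j (density x) := prod_nonneg fun j hj => (hU j hj).le
  have h2 : (N : ℝ) * ((∑ j ∈ ι, η j) * ∏ j ∈ ι, u j (density x)) ≤
      N * (1 / 2 * ∏ j ∈ ι, u j (density x)) := by
    gcongr
    exact h.tail
  have h3 : ∏ j ∈ ι, ∏ p ∈ B j, (1 - density x p) ≤ ∏ j ∈ ι, u j (density x) :=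
    prod_le_prod (fun j hj => (hV j hj).le) fun j hj => (hbon j hj).1
  have h4 := mul_le_mul_of_nonneg_left h3 (Nat.cast_nonneg (α := ℝ) N)
  linarith

end IsBlockSieve

/-! ### The residue classes to be avoided -/

/-- Exactly one `n` in a period solves the linear congruence `a * (n + 1) + b ≡ 0 [MOD q]`. -/
theorem sum_range_ite_dvd_eq_one {a q : ℕ} (b : ℕ) (hq : 0 < q) (haq : a.Coprime q) :
    ∑ n ∈ range q, (if q ∣ a * (n + 1) + b then 1 else 0 : ℝ) = 1 := by
  have : NeZero q := ⟨hq.ne'⟩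
  let u := ZMod.unitOfCoprime a haq
  have hu : (u : ZMod q) = a := ZMod.coe_unitOfCoprime a haq
  set n₀ : ZMod q := -(↑u⁻¹ * (b : ZMod q)) - 1 with hn₀
  have key : ∀ n ∈ range q, (q ∣ a * (n + 1) + b) ↔ n = n₀.val := by
    intro n hn
    rw [← ZMod.natCast_eq_zero_iff]
    push_cast
    rw [← hu]
    have h1 : ((u : ZMod q) * (n + 1) + b = 0) ↔ (n : ZMod q) = n₀ := by
      rw [hn₀]
      constructor
      · intro h
        have h2 : (↑u⁻¹ : ZMod q) * ((u : ZMod q) * (n + 1) + b) = 0 := by rw [h, mul_zero]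
        rw [mul_add, ← mul_assoc, Units.inv_mul, one_mul] at h2
        linear_combination h2
      · intro h
        rw [h]
        have h2 := Units.mul_inv u
        linear_combination (-(b : ZMod q)) * h2
    rw [h1]
    constructor
    · intro h
      rw [← h, ZMod.val_cast_of_lt (mem_range.1 hn)]
    · intro h
      rw [h, ZMod.natCast_zmod_val]
  rw [sum_congr rfl fun n hn => if_congr (key n hn) rfl rfl, sum_ite_eq' (range q)]
  simp [ZMod.val_lt]

theorem periodic_ite_dvd (a b q : ℕ) :
    Function.Periodic (fun n : ℕ => (if q ∣ a * (n + 1) + b then 1 else 0 : ℝ)) q := by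
  intro n
  have h : a * (n + q + 1) + b = a * (n + 1) + b + q * a := by ring
  simp only [h, Nat.dvd_add_left (dvd_mul_right q a)]

/-- The multiples of this number are the integers `n` among which the solution is sought: it is
divisible by `p ^ t` for each prime `p ≤ 2 ^ t`, so that for `k < 2 ^ t` such primes divide `n + k`
exactly as often as they divide `k`. -/
def smoothModulus (t : ℕ) : ℕ := primorial (2 ^ t) ^ t

theorem smoothModulus_pos (t : ℕ) : 0 < smoothModulus t := pow_pos (primorial_pos _) _

theorem pow_dvd_smoothModulus {t p : ℕ} (hp : p.Prime) (hpt : p ≤ 2 ^ t) :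
    p ^ t ∣ smoothModulus t :=
  pow_dvd_pow_of_dvd (dvd_prod_of_mem _ (by simp [hp]; omega)) t

theorem smoothModulus_le {t : ℕ} : smoothModulus t ≤ 2 ^ 4 ^ t := by
  calc smoothModulus t ≤ (4 ^ 2 ^ t) ^ t := Nat.pow_le_pow_left (primorial_le_four_pow _) t
    _ = 2 ^ (2 ^ t * (2 * t)) := by
        rw [show (4 : ℕ) = 2 ^ 2 by rfl, ← pow_mul, ← pow_mul]; ring_nf
    _ ≤ 2 ^ (2 ^ t * 2 ^ t) := by
        refine Nat.pow_le_pow_right (by norm_num) (Nat.mul_le_mul_left _ ?_)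
        rcases t with _ | t
        · simp
        · have := Nat.lt_two_pow_self (n := t)
          rw [pow_succ]; omega
    _ = 2 ^ 4 ^ t := by rw [← mul_pow]; norm_num

theorem le_smoothModulus {t : ℕ} (ht : 0 < t) : 2 ^ t ≤ smoothModulus t :=
  Nat.le_of_dvd (smoothModulus_pos t)
    (pow_dvd_smoothModulus Nat.prime_two (Nat.le_self_pow ht.ne' 2))

theorem coprime_smoothModulus {t p : ℕ} (hp : p.Prime) (hpt : 2 ^ t < p) :
    (smoothModulus t).Coprime p := by
  refine Nat.Coprime.pow_left _ (Nat.Coprime.prod_left fun q hq => ?_)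
  rw [mem_filter, mem_range] at hq
  exact (Nat.coprime_primes hq.2 hp).2 (by omega)

open Classical in
/-- The indicator function of the `n` to be sieved out by the prime `p`: those for which `p` divides
`smoothModulus t * (n + 1) + k` for some `k` that is required to have no prime factor as small as
`p`. The requirement for `k` concerns the primes below `2 ^ 4 ^ (t - log₂ k)`. -/
noncomputable def forbidden (t p n : ℕ) : ℝ :=
  if ∃ k, 1 ≤ k ∧ k < 2 ^ t ∧ p < 2 ^ 4 ^ (t - Nat.log 2 k) ∧ p ∣ smoothModulus t * (n + 1) + k
  then 1 else 0

theorem forbidden_nonneg (t p n : ℕ) : 0 ≤ forbidden t p n := by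
  unfold forbidden; split_ifs <;> norm_num

theorem forbidden_le_one (t p n : ℕ) : forbidden t p n ≤ 1 := by
  unfold forbidden; split_ifs <;> norm_num

open Classical in
theorem periodic_forbidden (t p : ℕ) : Function.Periodic (forbidden t p) p := by
  intro n
  have h : ∀ k, smoothModulus t * (n + p + 1) + k =
      smoothModulus t * (n + 1) + k + p * smoothModulus t := fun k => by ring
  unfold forbidden
  refine if_congr (exists_congr fun k => ?_) rfl rfl
  rw [h, Nat.dvd_add_left (dvd_mul_right p _)]

/-- The `j`-th block of primes to sieve by; the larger `j`, the smaller the primes. -/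
def primeBlock (t j : ℕ) : Finset ℕ :=
  (Ico (2 ^ 4 ^ (t - j)) (2 ^ 4 ^ (t - j + 1))).filter Nat.Prime

theorem mem_primeBlock {t j p : ℕ} :
    p ∈ primeBlock t j ↔ (2 ^ 4 ^ (t - j) ≤ p ∧ p < 2 ^ 4 ^ (t - j + 1)) ∧ p.Prime := by
  simp [primeBlock]

section Parameters

variable {s t : ℕ}

theorem two_pow_lt_of_mem_primeBlock (hs : 3 ≤ s) (hts : t = 4 ^ s) {j p : ℕ}
    (hj : j ∈ Icc 1 (t - s)) (hp : p ∈ primeBlock t j) : 2 ^ t < p := by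
  rw [mem_Icc] at hj
  rw [mem_primeBlock] at hp
  have hst : s < t := hts ▸ Nat.lt_pow_self (by norm_num)
  have h1 : 2 ^ t ≤ p := by
    refine le_trans ?_ hp.1.1
    refine Nat.pow_le_pow_right (by norm_num) ?_
    conv_lhs => rw [hts]
    exact Nat.pow_le_pow_right (by norm_num) (by omega)
  refine lt_of_le_of_ne h1 fun h => ?_
  have := hp.2
  rw [← h] at this
  exact Nat.Prime.not_prime_pow (by omega) this

/-- Only the shifts `k < 2 ^ j` matter for the primes of block `j`. -/
theorem sum_forbidden_le (hs : 3 ≤ s) (hts : t = 4 ^ s) {j p : ℕ} (hj : j ∈ Icc 1 (t - s))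
    (hp : p ∈ primeBlock t j) : ∑ n ∈ range p, forbidden t p n ≤ 2 ^ j := by
  have hlt := two_pow_lt_of_mem_primeBlock hs hts hj hp
  rw [mem_primeBlock] at hp
  have hcop := coprime_smoothModulus hp.2 hlt
  calc ∑ n ∈ range p, forbidden t p n
      ≤ ∑ n ∈ range p, ∑ k ∈ range (2 ^ j),
          (if p ∣ smoothModulus t * (n + 1) + k then 1 else 0 : ℝ) := by
        refine sum_le_sum fun n _ => ?_
        have hnn : ∀ k ∈ range (2 ^ j),
            0 ≤ (if p ∣ smoothModulus t * (n + 1) + k then 1 else 0 : ℝ) := fun k _ => by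
          split_ifs <;> norm_num
        unfold forbidden
        split_ifs with h
        · obtain ⟨k, hk1, -, hkp, hd⟩ := h
          have h1 := (Nat.pow_lt_pow_iff_right (by norm_num)).1 (hp.1.1.trans_lt hkp)
          have h2 := (Nat.pow_lt_pow_iff_right (by norm_num)).1 h1
          have h3 : k < 2 ^ j := Nat.lt_pow_of_log_lt (by norm_num) (by omega)
          refine le_trans ?_ (single_le_sum hnn (mem_range.2 h3))
          rw [if_pos hd]
        · exact sum_nonneg hnn
    _ = 2 ^ j := by
        rw [sum_comm, sum_congr rfl fun k _ => sum_range_ite_dvd_eq_one k hp.2.pos hcop]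
        simp

theorem density_forbidden_le (hs : 3 ≤ s) (hts : t = 4 ^ s) {j p : ℕ} (hj : j ∈ Icc 1 (t - s))
    (hp : p ∈ primeBlock t j) : density (forbidden t) p ≤ 2 ^ j * (1 / p) := by
  rw [density, mul_one_div]
  exact div_le_div_of_nonneg_right (sum_forbidden_le hs hts hj hp) (Nat.cast_nonneg p)

theorem exp_natCast_le (n : ℕ) : Real.exp n ≤ 4 ^ n := by
  rw [← mul_one (n : ℝ), Real.exp_nat_mul]
  exact pow_le_pow_left₀ (Real.exp_pos _).le (by linarith [Real.exp_one_lt_d9]) n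

/-- The truncation degree `100 * 2 ^ j` exceeds the density bound `12 * 2 ^ j` by enough for the tails
to be summable over `j`, while it keeps the degree times `4 ^ (t - j)` summable as well. The choice
`t = 4 ^ s` makes the last block `j = t - s` end at `2 ^ 4 ^ s = 2 ^ t`, below which the primes are
taken care of by `smoothModulus t`. -/
theorem isBlockSieve_forbidden (hs : 3 ≤ s) (hts : t = 4 ^ s) :
    IsBlockSieve (forbidden t) (Icc 1 (t - s)) (primeBlock t) (fun j => 50 * 2 ^ j)
      (fun j => 2 ^ 4 ^ (t - j + 1)) (fun j => 12 * 2 ^ j) where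
  nonneg := forbidden_nonneg t
  le_one := forbidden_le_one t
  prime j _ p hp := (mem_primeBlock.1 hp).2
  disjoint := by
    have key : ∀ i j p : ℕ, i < j → j ≤ t → p ∈ primeBlock t i → p ∈ primeBlock t j → False := by
      intro i j p hij hjt hi hj
      rw [mem_primeBlock] at hi hj
      have h1 : 2 ^ 4 ^ (t - j + 1) ≤ 2 ^ 4 ^ (t - i) :=
        Nat.pow_le_pow_right (by norm_num) (Nat.pow_le_pow_right (by norm_num) (by omega))
      omega
    intro i hi j hj hij
    simp only [coe_Icc, Set.mem_Icc] at hi hj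
    refine disjoint_left.2 fun p hpi hpj => ?_
    rcases lt_or_gt_of_ne hij with h | h
    · exact key i j p h (by omega) hpi hpj
    · exact key j i p h (by omega) hpj hpi
  periodic _ _ p _ := periodic_forbidden t p
  density_le j hj p hp := by
    have hlt := two_pow_lt_of_mem_primeBlock hs hts hj hp
    have hst : s < t := hts ▸ Nat.lt_pow_self (by norm_num)
    refine (density_forbidden_le hs hts hj hp).trans ?_
    rw [mem_Icc] at hj
    have h1 : 2 ^ j * 8 ≤ p := by
      calc 2 ^ j * 8 = 2 ^ (j + 3) := by ring
        _ ≤ 2 ^ t := Nat.pow_le_pow_right (by norm_num) (by omega)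
        _ ≤ p := hlt.le
    have h2 : (2 : ℝ) ^ j * 8 ≤ p := by exact_mod_cast h1
    have h3 : (0 : ℝ) < p := lt_of_lt_of_le (by positivity) h2
    rw [mul_one_div, div_le_div_iff₀ h3 (by norm_num)]
    linarith
  sum_density_le j hj := by
    refine (sum_le_sum fun p hp => density_forbidden_le hs hts hj hp).trans ?_
    rw [← mul_sum, mul_comm]
    refine mul_le_mul_of_nonneg_right ?_ (by positivity)
    simpa [primeBlock] using sum_inv_primes_two_pow_four_pow_le (t - j) 1
  le_Y j _ p hp := by exact_mod_cast (mem_primeBlock.1 hp).1.2.le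
  one_le_Y j _ := one_le_pow₀ (by norm_num)
  tail := by
    have h1 : ∀ j : ℕ, (1 / 2 : ℝ) ^ (2 * (50 * 2 ^ j) + 1) * Real.exp (4 * (12 * 2 ^ j)) ≤
        (1 / 2) ^ (j + 1) := by
      intro j
      have h2 : Real.exp (4 * (12 * 2 ^ j)) ≤ 2 ^ (96 * 2 ^ j) := by
        have := exp_natCast_le (48 * 2 ^ j)
        rw [show (4 : ℝ) = 2 ^ 2 by norm_num, ← pow_mul] at this
        push_cast at this
        calc _ = Real.exp (48 * 2 ^ j) := by ring_nf
          _ ≤ _ := this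
          _ = _ := by ring_nf
      have h3 : j < 2 ^ j := Nat.lt_two_pow_self
      calc _ ≤ (1 / 2 : ℝ) ^ (2 * (50 * 2 ^ j) + 1) * 2 ^ (96 * 2 ^ j) :=
            mul_le_mul_of_nonneg_left h2 (by positivity)
        _ = (1 / 2 : ℝ) ^ (4 * 2 ^ j + 1) * ((1 / 2) ^ (96 * 2 ^ j) * 2 ^ (96 * 2 ^ j)) := by
            rw [show 2 * (50 * 2 ^ j) + 1 = 4 * 2 ^ j + 1 + 96 * 2 ^ j by ring, pow_add _ _ (96 * _),
              mul_assoc]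
        _ = (1 / 2 : ℝ) ^ (4 * 2 ^ j + 1) := by rw [← mul_pow]; norm_num
        _ ≤ _ := pow_le_pow_of_le_one (by norm_num) (by norm_num) (by omega)
    refine (sum_le_sum fun j _ => h1 j).trans ?_
    have h2 : ∀ J : ℕ, ∑ j ∈ Icc 1 J, (1 / 2 : ℝ) ^ (j + 1) = 1 / 2 - (1 / 2) ^ (J + 1) := by
      intro J
      induction J with
      | zero => simp
      | succ J ih => rw [sum_Icc_succ_top (by omega), ih]; ring
    rw [h2]
    linarith [show (0 : ℝ) < (1 / 2) ^ (t - s + 1) by positivity]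

theorem sum_two_pow_sub_le (t J : ℕ) (hJ : J ≤ t) : ∑ j ∈ Icc 1 J, 2 ^ (t - j) ≤ 2 ^ t := by
  have : ∑ j ∈ Icc 1 J, 2 ^ (t - j) + 2 ^ (t - J) = 2 ^ t := by
    induction J with
    | zero => simp
    | succ J ih =>
      rw [sum_Icc_succ_top (by omega), ← ih (by omega), show t - J = t - (J + 1) + 1 by omega,
        pow_succ]
      ring
  exact this ▸ Nat.le_add_right _ _

/-- The exponents `4 ^ (t - j + 1) * (100 * 2 ^ j + 1)` sum to a geometric series dominated by its
first term, so the sieve has level a fixed power of `2 ^ 4 ^ t`. -/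
theorem sieve_error_le (hs : 3 ≤ s) (hts : t = 4 ^ s) :
    ∏ j ∈ Icc 1 (t - s), ((2 : ℝ) ^ 4 ^ (t - j + 1)) ^ (2 * (50 * 2 ^ j) + 1) *
      Real.exp (12 * 2 ^ j) ≤ (2 ^ 4 ^ t) ^ 405 := by
  have h1 : ∀ j ∈ Icc 1 (t - s), ((2 : ℝ) ^ 4 ^ (t - j + 1)) ^ (2 * (50 * 2 ^ j) + 1) *
      Real.exp (12 * 2 ^ j) ≤ 2 ^ (405 * 2 ^ t * 2 ^ (t - j)) := by
    intro j hj
    rw [mem_Icc] at hj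
    have h2 : Real.exp (12 * 2 ^ j) ≤ 2 ^ (24 * 2 ^ j) := by
      have := exp_natCast_le (12 * 2 ^ j)
      rw [show (4 : ℝ) = 2 ^ 2 by norm_num, ← pow_mul] at this
      push_cast at this
      exact this.trans_eq (by ring_nf)
    refine (mul_le_mul_of_nonneg_left h2 (by positivity)).trans ?_
    rw [← pow_mul, ← pow_add]
    refine pow_le_pow_right₀ (by norm_num) ?_
    obtain ⟨i, hi⟩ : ∃ i, t = j + i := ⟨t - j, by omega⟩
    have hi3 : 3 ≤ i := by omega
    have e : t - j = i := by omega
    rw [e, hi]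
    have h3 : 1 ≤ 2 ^ j := Nat.one_le_two_pow
    have h4 : 2 ^ 3 ≤ 2 ^ i := Nat.pow_le_pow_right (by norm_num) hi3
    have h5 : 4 ^ i = 2 ^ i * 2 ^ i := by rw [← mul_pow]; norm_num
    rw [pow_succ, h5, pow_add]
    generalize 2 ^ i = a at *
    generalize 2 ^ j = b at *
    have h6 : 8 * 8 ≤ a * a := Nat.mul_le_mul h4 h4
    calc a * a * 4 * (2 * (50 * b) + 1) + 24 * b
        ≤ a * a * 4 * (101 * b) + a * a * b := by
          refine Nat.add_le_add (Nat.mul_le_mul_left _ (by omega)) ?_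
          exact Nat.mul_le_mul_right _ (by omega)
      _ = 405 * (b * a) * a := by ring
  calc _ ≤ ∏ j ∈ Icc 1 (t - s), (2 : ℝ) ^ (405 * 2 ^ t * 2 ^ (t - j)) :=
        prod_le_prod (fun j _ => by positivity) h1
    _ = 2 ^ (405 * 2 ^ t * ∑ j ∈ Icc 1 (t - s), 2 ^ (t - j)) := by
        rw [prod_pow_eq_pow_sum, mul_sum]
    _ ≤ 2 ^ (405 * 2 ^ t * 2 ^ t) := by
        refine pow_le_pow_right₀ (by norm_num) (Nat.mul_le_mul_left _ ?_)
        exact sum_two_pow_sub_le t _ (by omega)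
    _ = _ := by
        rw [← pow_mul]
        congr 1
        rw [mul_assoc, ← mul_pow]
        ring

/-- The proportion of sifted integers is at least `exp (-O(2 ^ t))`. -/
theorem one_div_le_sieve_product (hs : 3 ≤ s) (hts : t = 4 ^ s) :
    1 / (2 : ℝ) ^ 4 ^ t ≤
      ∏ j ∈ Icc 1 (t - s), ∏ p ∈ primeBlock t j, (1 - density (forbidden t) p) := by
  have h := isBlockSieve_forbidden hs hts
  have ht : 64 ≤ t := by
    rw [hts]
    calc 64 = 4 ^ 3 := by norm_num
      _ ≤ 4 ^ s := Nat.pow_le_pow_right (by norm_num) hs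
  refine le_trans ?_ (prod_le_prod (fun j _ => (Real.exp_pos _).le)
    fun j hj => h.exp_le_prod_one_sub_density hj)
  rw [← Real.exp_sum, sum_neg_distrib, Real.exp_neg, one_div]
  refine inv_anti₀ (Real.exp_pos _) ?_
  have h1 : ∑ j ∈ Icc 1 (t - s), 2 ^ j ≤ 2 * 2 ^ t := by
    have h2 : ∀ J : ℕ, ∑ j ∈ Icc 1 J, 2 ^ j + 2 = 2 * 2 ^ J := by
      intro J
      induction J with
      | zero => simp
      | succ J ih => rw [sum_Icc_succ_top (by omega), pow_succ]; omega
    have h3 : 2 ^ (t - s) ≤ 2 ^ t := Nat.pow_le_pow_right (by norm_num) (by omega)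
    have := h2 (t - s)
    omega
  calc Real.exp (∑ j ∈ Icc 1 (t - s), 2 * (12 * (2 : ℝ) ^ j))
      = Real.exp ((24 * ∑ j ∈ Icc 1 (t - s), 2 ^ j : ℕ) : ℝ) := by
        congr 1
        push_cast
        rw [mul_sum]
        exact sum_congr rfl fun j _ => by ring
    _ ≤ 4 ^ (24 * ∑ j ∈ Icc 1 (t - s), 2 ^ j) := exp_natCast_le _
    _ ≤ 4 ^ (48 * 2 ^ t) := pow_le_pow_right₀ (by norm_num) (by omega)
    _ = 2 ^ (96 * 2 ^ t) := by
        rw [show (4 : ℝ) = 2 ^ 2 by norm_num, ← pow_mul]; ring_nf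
    _ ≤ 2 ^ 4 ^ t := by
        refine pow_le_pow_right₀ (by norm_num) ?_
        rw [show (4 : ℕ) ^ t = 2 ^ t * 2 ^ t by rw [← mul_pow]; norm_num]
        refine Nat.mul_le_mul_right _ ?_
        calc 96 ≤ 2 ^ 7 := by norm_num
          _ ≤ 2 ^ t := Nat.pow_le_pow_right (by norm_num) (by omega)

end Parameters

/-! ### The union bound -/

/-- The quotient of `smoothModulus t * (n + 1) + k` by its greatest common divisor with
`smoothModulus t`, which does not depend on `n`. -/
def roughPart (t k n : ℕ) : ℕ :=
  smoothModulus t / (smoothModulus t).gcd k * (n + 1) + k / (smoothModulus t).gcd k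

theorem gcd_mul_roughPart (t k n : ℕ) :
    (smoothModulus t).gcd k * roughPart t k n = smoothModulus t * (n + 1) + k := by
  rw [roughPart, mul_add, ← mul_assoc, Nat.mul_div_cancel' (Nat.gcd_dvd_left _ _),
    Nat.mul_div_cancel' (Nat.gcd_dvd_right _ _)]

theorem coprime_div_gcd (t k : ℕ) :
    (smoothModulus t / (smoothModulus t).gcd k).Coprime (k / (smoothModulus t).gcd k) :=
  Nat.coprime_div_gcd_div_gcd (Nat.gcd_pos_of_pos_left _ (smoothModulus_pos t))

open Classical in
/-- The candidates for divisors of `roughPart t k n`: products of `r` primes which are not too small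
in terms of `k`. -/
noncomputable def roughDivisors (t k r : ℕ) : Finset ℕ :=
  (Icc 1 (2 ^ 4 ^ t)).filter fun d => ArithmeticFunction.cardFactors d = r ∧
    ∀ p, p.Prime → p ∣ d → 2 ^ 4 ^ (t - Nat.log 2 k) ≤ p

theorem mem_roughDivisors {t k r d : ℕ} :
    d ∈ roughDivisors t k r ↔ (1 ≤ d ∧ d ≤ 2 ^ 4 ^ t) ∧ ArithmeticFunction.cardFactors d = r ∧
      ∀ p, p.Prime → p ∣ d → 2 ^ 4 ^ (t - Nat.log 2 k) ≤ p := by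
  simp [roughDivisors]

section Parameters

variable {s t : ℕ}

/-- Prime factors of `roughPart t k n` for sifted `n` are large. -/
theorem le_of_prime_dvd_roughPart (hs : 3 ≤ s) (hts : t = 4 ^ s) {n k p : ℕ} (hk : 1 ≤ k)
    (hn : ∀ j ∈ Icc 1 (t - s), ∀ p ∈ primeBlock t j, forbidden t p n = 0) (hp : p.Prime)
    (hpk : p ∣ roughPart t k n) : 2 ^ 4 ^ (t - Nat.log 2 k) ≤ p := by
  rcases le_or_gt (2 ^ t) k with hkt | hkt
  · have : t ≤ Nat.log 2 k := Nat.le_log_of_pow_le (by norm_num) hkt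
    rw [Nat.sub_eq_zero_of_le this]
    simpa using hp.two_le
  have hpt : 2 ^ t < p := by
    by_contra! hpt
    have h1 : p ∣ smoothModulus t / (smoothModulus t).gcd k := by
      by_contra h1
      have h2 := pow_dvd_smoothModulus hp hpt
      rw [← Nat.mul_div_cancel' (Nat.gcd_dvd_left (smoothModulus t) k)] at h2
      have h3 : (p ^ t).Coprime (smoothModulus t / (smoothModulus t).gcd k) :=
        Nat.Coprime.pow_left _ ((hp.coprime_iff_not_dvd).2 h1)
      have h4 : p ^ t ∣ k := (h3.dvd_of_dvd_mul_right h2).trans (Nat.gcd_dvd_right _ _)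
      have h5 := Nat.le_of_dvd hk h4
      have h6 := Nat.pow_le_pow_left hp.two_le t
      omega
    have h2 : p ∣ k / (smoothModulus t).gcd k := (Nat.dvd_add_right (h1.mul_right _)).1 hpk
    exact hp.not_dvd_one ((coprime_div_gcd t k) ▸ Nat.dvd_gcd h1 h2)
  by_contra! hlt
  -- `i` is the index with `2 ^ 4 ^ i ≤ p < 2 ^ 4 ^ (i + 1)`
  set i := Nat.log 4 (Nat.log 2 p) with hi
  have hlog : Nat.log 2 p ≠ 0 := (Nat.log_pos (by norm_num) hp.two_le).ne'
  have h1 : 2 ^ 4 ^ i ≤ p :=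
    Nat.pow_le_of_le_log hp.ne_zero (Nat.pow_log_le_self 4 hlog)
  have h2 : p < 2 ^ 4 ^ (i + 1) :=
    Nat.lt_pow_of_log_lt (by norm_num) (Nat.lt_pow_succ_log_self (by norm_num) _)
  have h3 : s < i + 1 := by
    have := hpt.trans h2
    rw [Nat.pow_lt_pow_iff_right (by norm_num)] at this
    conv_lhs at this => rw [hts]
    exact (Nat.pow_lt_pow_iff_right (by norm_num)).1 this
  have h4 : i < t - Nat.log 2 k :=
    (Nat.pow_lt_pow_iff_right (by norm_num)).1
      ((Nat.pow_lt_pow_iff_right (by norm_num)).1 (h1.trans_lt hlt))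
  have hst : s < t := hts ▸ Nat.lt_pow_self (by norm_num)
  have h5 := hn (t - i) (mem_Icc.2 ⟨by omega, by omega⟩) p (mem_primeBlock.2 (by
    rw [show t - (t - i) = i by omega]; exact ⟨⟨h1, h2⟩, hp⟩))
  have h6 : p ∣ smoothModulus t * (n + 1) + k := by
    rw [← gcd_mul_roughPart]; exact hpk.mul_left _
  unfold forbidden at h5
  rw [if_pos ⟨k, hk, hkt, hlt, h6⟩] at h5
  exact one_ne_zero h5

/-- An upper bound for the number of sifted `n` for which `d` divides `roughPart t k n`. If `d` is
coprime to the leading coefficient, these `n` form a residue class modulo `d`; otherwise there are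
none. -/
theorem sum_ite_dvd_roughPart_le (hs : 3 ≤ s) (hts : t = 4 ^ s) (N k d : ℕ) (hd : 0 < d) :
    ∑ n ∈ range N, (if d ∣ roughPart t k n then 1 else 0 : ℝ) *
        ∏ j ∈ Icc 1 (t - s), ∏ p ∈ primeBlock t j, (1 - forbidden t p n) ≤
      2 * (N / d) * (8 / 7) ^ (ArithmeticFunction.cardFactors d) *
        ∏ j ∈ Icc 1 (t - s), ∏ p ∈ primeBlock t j, (1 - density (forbidden t) p) +
      (2 ^ 4 ^ t) ^ 405 := by
  have h := isBlockSieve_forbidden hs hts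
  have hV : 0 ≤ ∏ j ∈ Icc 1 (t - s), ∏ p ∈ primeBlock t j, (1 - density (forbidden t) p) :=
    le_trans (by positivity) (one_div_le_sieve_product hs hts)
  by_cases hcop : (smoothModulus t / (smoothModulus t).gcd k).Coprime d
  · refine (h.sum_weighted_prod_le N hd (periodic_ite_dvd _ _ d)
      (fun n => by split_ifs <;> norm_num)
      (sum_range_ite_dvd_eq_one _ hd hcop)).trans ?_
    exact add_le_add le_rfl (sieve_error_le hs hts)
  · rw [sum_eq_zero]
    · positivity
    intro n _
    rw [if_neg, zero_mul]
    intro hdvd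
    obtain ⟨p, hp, h1, h2⟩ := Nat.Prime.not_coprime_iff_dvd.1 hcop
    have h3 : p ∣ k / (smoothModulus t).gcd k :=
      (Nat.dvd_add_right (h1.mul_right _)).1 (h2.trans hdvd)
    exact hp.not_dvd_one ((coprime_div_gcd t k) ▸ Nat.dvd_gcd h1 h3)

/-- The sum over `d` from the union bound, for fixed `k`: the primes in question have a reciprocal sum
of at most `12 * (log₂ k + 1)`, which a large multiple `R * log₂ k` of prime factors outweighs. -/
theorem sum_roughDivisors_le {R k : ℕ}
    (hR : (16 / 21 : ℝ) ^ R * Real.exp 144 ≤ 1 / 256) (hk : 2 ≤ k) :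
    ∑ d ∈ roughDivisors t k (R * Nat.log 2 k), (1 / d : ℝ) *
        (8 / 7) ^ (ArithmeticFunction.cardFactors d) ≤ (1 / 256) ^ Nat.log 2 k := by
  set l := Nat.log 2 k with hl
  have hl1 : 1 ≤ l := Nat.log_pos (by norm_num) hk
  have h1 : ∑ d ∈ roughDivisors t k (R * l), (1 / d : ℝ) ≤
      (2 / 3) ^ (R * l) * Real.exp (6 * (12 * (l + 1))) := by
    refine sum_inv_le_of_cardFactors_eq
      ((Ico (2 ^ 4 ^ (t - l)) (2 ^ 4 ^ (t + 1))).filter Nat.Prime) _ _ _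
      (fun p hp => (mem_filter.1 hp).2) ?_ fun d hd => ?_
    · have h2 := sum_inv_primes_two_pow_four_pow_le (t - l) (t + 1 - (t - l))
      rw [show t - l + (t + 1 - (t - l)) = t + 1 by omega] at h2
      refine h2.trans ?_
      have h3 : ((t + 1 - (t - l) : ℕ) : ℝ) ≤ ((l + 1 : ℕ) : ℝ) := by
        exact_mod_cast (by omega : t + 1 - (t - l) ≤ l + 1)
      push_cast at h3 ⊢
      linarith
    · rw [mem_roughDivisors] at hd
      refine ⟨by omega, hd.2.1, fun p hp hpd => ?_⟩
      rw [mem_filter, mem_Ico]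
      refine ⟨⟨hd.2.2 p hp hpd, ?_⟩, hp⟩
      calc p ≤ d := Nat.le_of_dvd hd.1.1 hpd
        _ ≤ 2 ^ 4 ^ t := hd.1.2
        _ < 2 ^ 4 ^ (t + 1) := Nat.pow_lt_pow_right (by norm_num)
            (Nat.pow_lt_pow_right (by norm_num) (by omega))
  have h2 : Real.exp (6 * (12 * ((l : ℝ) + 1))) ≤ Real.exp 144 ^ l := by
    rw [← Real.exp_nat_mul]
    refine Real.exp_le_exp.2 ?_
    have : (1 : ℝ) ≤ l := by exact_mod_cast hl1
    linarith
  calc _ = (8 / 7 : ℝ) ^ (R * l) * ∑ d ∈ roughDivisors t k (R * l), (1 / d : ℝ) := by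
        rw [mul_sum]
        refine sum_congr rfl fun d hd => ?_
        rw [(mem_roughDivisors.1 hd).2.1, mul_comm]
    _ ≤ (8 / 7 : ℝ) ^ (R * l) * ((2 / 3) ^ (R * l) * Real.exp 144 ^ l) := by
        refine mul_le_mul_of_nonneg_left (h1.trans ?_) (by positivity)
        exact mul_le_mul_of_nonneg_left h2 (by positivity)
    _ = ((16 / 21 : ℝ) ^ R * Real.exp 144) ^ l := by
        rw [← mul_assoc, ← mul_pow, mul_pow _ _ l, ← pow_mul]
        norm_num
    _ ≤ _ := pow_le_pow_left₀ (by positivity) hR l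

theorem sum_pow_log_le (K : ℕ) :
    ∑ k ∈ Ico 2 K, (1 / 256 : ℝ) ^ Nat.log 2 k ≤ 1 / 16 := by
  have h1 : ∀ K : ℕ, ∑ k ∈ Ico 2 (K + 2), (1 / 256 : ℝ) ^ Nat.log 2 k ≤
      1 / 16 * (1 - 1 / (K + 1)) := by
    intro K
    induction K with
    | zero => simp
    | succ K ih =>
      rw [sum_Ico_succ_top (by omega)]
      have hl1 : 1 ≤ Nat.log 2 (K + 2) := Nat.log_pos (by norm_num) (by omega)
      have hlt := Nat.lt_pow_succ_log_self (b := 2) (by norm_num) (K + 2)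
      set l := Nat.log 2 (K + 2)
      have h2 : ((K : ℝ) + 2) < 2 * 2 ^ l := by
        have : ((K + 2 : ℕ) : ℝ) < ((2 ^ (l + 1) : ℕ) : ℝ) := by exact_mod_cast hlt
        push_cast at this
        rw [pow_succ] at this
        linarith
      have hK : (0 : ℝ) ≤ K := Nat.cast_nonneg K
      have h3 : ((K : ℝ) + 2) ^ 2 ≤ 4 * 4 ^ l := by
        have : (4 : ℝ) ^ l = 2 ^ l * 2 ^ l := by rw [← mul_pow]; norm_num
        nlinarith
      have h4 : (1 / 256 : ℝ) ^ l ≤ 1 / 16 * (1 / ((K + 1) * (K + 2))) := by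
        calc (1 / 256 : ℝ) ^ l = (1 / 64) ^ l * (1 / 4) ^ l := by rw [← mul_pow]; norm_num
          _ ≤ 1 / 64 * (1 / 4) ^ l := by
              refine mul_le_mul_of_nonneg_right ?_ (by positivity)
              exact pow_le_of_le_one (by norm_num) (by norm_num) (by omega)
          _ ≤ 1 / 64 * (4 / (K + 2) ^ 2) := by
              refine mul_le_mul_of_nonneg_left ?_ (by norm_num)
              rw [one_div_pow, div_le_div_iff₀ (by positivity) (by positivity)]
              linarith
          _ ≤ _ := by
              rw [show (1 / 64 : ℝ) * (4 / (K + 2) ^ 2) = 1 / 16 * (1 / (K + 2) ^ 2) by ring]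
              refine mul_le_mul_of_nonneg_left ?_ (by norm_num)
              exact one_div_le_one_div_of_le (by positivity) (by nlinarith)
      have h5 : (1 : ℝ) / ((K + 1) * (K + 2)) = 1 / (K + 1) - 1 / (K + 2) := by
        field_simp
        ring
      rw [h5] at h4
      push_cast
      rw [show (K : ℝ) + 1 + 1 = K + 2 by ring]
      linarith
  rcases le_or_gt K 2 with hK | hK
  · rw [Ico_eq_empty (by omega), sum_empty]; norm_num
  · have := h1 (K - 2)
    rw [show K - 2 + 2 = K by omega] at this
    refine this.trans ?_
    have : (0 : ℝ) ≤ 1 / (((K - 2 : ℕ) : ℝ) + 1) := by positivity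
    linarith

/-- By the union bound, some sifted `n` makes none of the `roughPart t k n` divisible by any of the
candidates `d`. -/
theorem exists_sifted (hs : 3 ≤ s) (hts : t = 4 ^ s) {R : ℕ}
    (hR : (16 / 21 : ℝ) ^ R * Real.exp 144 ≤ 1 / 256) :
    ∃ n < (2 ^ 4 ^ t) ^ 410,
      (∀ j ∈ Icc 1 (t - s), ∀ p ∈ primeBlock t j, forbidden t p n = 0) ∧
      ∀ k ∈ Ico 2 (2 ^ 4 ^ t), ∀ d ∈ roughDivisors t k (R * Nat.log 2 k),
        ¬ d ∣ roughPart t k n := by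
  by_contra! hcon
  set Z : ℕ := 2 ^ 4 ^ t with hZ
  set N := Z ^ 410 with hN
  set v : ℕ → ℝ := fun n => ∏ j ∈ Icc 1 (t - s), ∏ p ∈ primeBlock t j, (1 - forbidden t p n)
    with hv
  set V := ∏ j ∈ Icc 1 (t - s), ∏ p ∈ primeBlock t j, (1 - density (forbidden t) p) with hVdef
  have hv0 : ∀ n, 0 ≤ v n := fun n => prod_nonneg fun j _ => prod_nonneg fun p _ => by
    linarith [forbidden_le_one t p n]
  have hVZ : 1 / (Z : ℝ) ≤ V := by
    rw [hZ]; push_cast; exact one_div_le_sieve_product hs hts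
  have hZ0 : (0 : ℝ) < Z := by rw [hZ]; positivity
  have hV0 : 0 < V := lt_of_lt_of_le (by positivity) hVZ
  have hpt : ∀ n ∈ range N, v n ≤ ∑ k ∈ Ico 2 Z, ∑ d ∈ roughDivisors t k (R * Nat.log 2 k),
      (if d ∣ roughPart t k n then 1 else 0 : ℝ) * v n := by
    intro n hn
    have hnn : ∀ k d, 0 ≤ (if d ∣ roughPart t k n then 1 else 0 : ℝ) * v n := fun k d =>
      mul_nonneg (by split_ifs <;> norm_num) (hv0 n)
    by_cases h : ∀ j ∈ Icc 1 (t - s), ∀ p ∈ primeBlock t j, forbidden t p n = 0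
    · obtain ⟨k, hk, d, hd, hdvd⟩ := hcon n (mem_range.1 hn) h
      calc v n = (if d ∣ roughPart t k n then 1 else 0 : ℝ) * v n := by rw [if_pos hdvd, one_mul]
        _ ≤ _ := single_le_sum (f := fun d => (if d ∣ roughPart t k n then 1 else 0 : ℝ) * v n)
              (fun d _ => hnn k d) hd
        _ ≤ _ := single_le_sum (f := fun k => ∑ d ∈ roughDivisors t k (R * Nat.log 2 k),
              (if d ∣ roughPart t k n then 1 else 0 : ℝ) * v n)
              (fun k _ => sum_nonneg fun d _ => hnn k d) hk
    · push Not at h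
      obtain ⟨j, hj, p, hp, hne⟩ := h
      have h1 : forbidden t p n = 1 := by
        unfold forbidden at hne ⊢
        split_ifs at hne ⊢ <;> simp_all
      have : v n = 0 := prod_eq_zero hj (prod_eq_zero hp (by rw [h1, sub_self]))
      rw [this]
      simp
  have hupper : ∑ n ∈ range N, v n ≤ N * V / 8 + Z ^ 2 * Z ^ 405 := by
    calc _ ≤ ∑ n ∈ range N, ∑ k ∈ Ico 2 Z, ∑ d ∈ roughDivisors t k (R * Nat.log 2 k),
            (if d ∣ roughPart t k n then 1 else 0 : ℝ) * v n := sum_le_sum hpt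
      _ = ∑ k ∈ Ico 2 Z, ∑ d ∈ roughDivisors t k (R * Nat.log 2 k), ∑ n ∈ range N,
            (if d ∣ roughPart t k n then 1 else 0 : ℝ) * v n := by
          rw [sum_comm]
          exact sum_congr rfl fun k _ => sum_comm
      _ ≤ ∑ k ∈ Ico 2 Z, (2 * N * V * (1 / 256) ^ Nat.log 2 k + Z * Z ^ 405) := by
          refine sum_le_sum fun k hk => ?_
          calc _ ≤ ∑ d ∈ roughDivisors t k (R * Nat.log 2 k),
                (2 * N * V * ((1 / d : ℝ) * (8 / 7) ^ (ArithmeticFunction.cardFactors d)) +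
                  (Z : ℝ) ^ 405) := by
                refine sum_le_sum fun d hd => ?_
                have := sum_ite_dvd_roughPart_le hs hts N k d (mem_roughDivisors.1 hd).1.1
                refine this.trans_eq ?_
                rw [hZ]
                push_cast
                ring
            _ ≤ _ := by
                rw [sum_add_distrib, ← mul_sum, sum_const, nsmul_eq_mul]
                refine add_le_add (mul_le_mul_of_nonneg_left
                  (sum_roughDivisors_le hR (mem_Ico.1 hk).1) (by positivity))
                  (mul_le_mul_of_nonneg_right ?_ (by positivity))
                have : #(roughDivisors t k (R * Nat.log 2 k)) ≤ Z := by
                  have h1 : roughDivisors t k (R * Nat.log 2 k) ⊆ Icc 1 Z := fun d hd =>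
                    mem_Icc.2 (mem_roughDivisors.1 hd).1
                  simpa using card_le_card h1
                exact_mod_cast this
      _ ≤ _ := by
          rw [sum_add_distrib, ← mul_sum, sum_const, nsmul_eq_mul, Nat.card_Ico]
          have h1 := mul_le_mul_of_nonneg_left (sum_pow_log_le Z)
            (show 0 ≤ 2 * (N : ℝ) * V by positivity)
          have h2 : ((Z - 2 : ℕ) : ℝ) ≤ Z := by exact_mod_cast Nat.sub_le Z 2
          have h3 := mul_le_mul_of_nonneg_right h2 (show (0 : ℝ) ≤ Z * Z ^ 405 by positivity)
          have h4 : (Z : ℝ) * (Z * Z ^ 405) = Z ^ 2 * Z ^ 405 := by ring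
          linarith
  have hlower := (isBlockSieve_forbidden hs hts).le_sum_prod N
  have herr := sieve_error_le hs hts
  rw [Nat.card_Icc] at hlower
  have htZ : t < Z := (Nat.lt_pow_self (by norm_num)).trans (Nat.lt_pow_self (by norm_num))
  have hJ : (1 : ℝ) + ((t - s + 1 - 1 : ℕ) : ℝ) ≤ Z := by
    exact_mod_cast (by omega : 1 + (t - s + 1 - 1) ≤ Z)
  have hE := mul_le_mul hJ herr (by positivity) hZ0.le
  have hZ64 : (64 : ℝ) ≤ Z := by
    have h1 : 64 ≤ t := by
      rw [hts]
      calc 64 = 4 ^ 3 := by norm_num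
        _ ≤ 4 ^ s := Nat.pow_le_pow_right (by norm_num) hs
    exact_mod_cast h1.trans htZ.le
  have hNV : (Z : ℝ) ^ 409 ≤ N * V := by
    calc (Z : ℝ) ^ 409 = N * (1 / Z) := by
          rw [hN]; push_cast; field_simp
      _ ≤ N * V := mul_le_mul_of_nonneg_left hVZ (Nat.cast_nonneg N)
  have hZc : ((2 : ℝ) ^ 4 ^ t) ^ 405 = (Z : ℝ) ^ 405 := by rw [hZ]; push_cast; rfl
  rw [hZc] at hE
  change (N : ℝ) / 2 * V - _ ≤ ∑ n ∈ range N, v n at hlower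
  have hfin : 3 / 8 * (N * V) ≤ Z * Z ^ 405 + Z ^ 2 * (Z : ℝ) ^ 405 := by
    linarith
  have h407 : (Z : ℝ) ^ 409 = Z ^ 2 * (Z ^ 2 * Z ^ 405) := by ring
  have hP : (0 : ℝ) < Z ^ 405 := by positivity
  have hQ : (Z : ℝ) * Z ^ 405 ≤ Z ^ 2 * Z ^ 405 := by
    refine mul_le_mul_of_nonneg_right ?_ hP.le
    nlinarith
  have hQ2 : (6 : ℝ) * (Z ^ 2 * Z ^ 405) ≤ Z ^ 2 * (Z ^ 2 * Z ^ 405) :=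
    mul_le_mul_of_nonneg_right (by nlinarith) (by positivity)
  have hQ3 : (0 : ℝ) < Z ^ 2 * Z ^ 405 := by positivity
  linarith

/-- For `k` beyond `2 ^ 4 ^ t` the trivial bound by the size of `n + k` suffices; below, `n + k` is the
product of a divisor of `k` and of a value of `roughPart t k`. -/
theorem exists_cardFactors_le (hs : 3 ≤ s) (hts : t = 4 ^ s) {R : ℕ} (hR1 : 1 ≤ R)
    (hR : (16 / 21 : ℝ) ^ R * Real.exp 144 ≤ 1 / 256) :
    ∃ n : ℕ, s < n ∧ ∀ k, 2 ≤ k →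
      ArithmeticFunction.cardFactors (n + k) ≤ 825 * R * Nat.log 2 k := by
  obtain ⟨n, hnN, hn, hdvd⟩ := exists_sifted hs hts hR
  have hst : s < t := hts ▸ Nat.lt_pow_self (by norm_num)
  have hM := smoothModulus_le (t := t)
  have hM1 := le_smoothModulus (show 0 < t by omega)
  refine ⟨smoothModulus t * (n + 1), ?_, fun k hk => ?_⟩
  · calc s < t := hst
      _ < 2 ^ t := Nat.lt_two_pow_self
      _ ≤ smoothModulus t := hM1
      _ ≤ _ := Nat.le_mul_of_pos_right _ (by omega)
  set Z : ℕ := 2 ^ 4 ^ t with hZ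
  have hZ2 : 2 ≤ Z := Nat.le_self_pow (by positivity) 2
  set l := Nat.log 2 k with hl
  have hl1 : 1 ≤ l := Nat.log_pos (by norm_num) hk
  have hm0 : smoothModulus t * (n + 1) + k ≠ 0 := by omega
  have hsize : ∀ K, Z ≤ K → k ≤ K → smoothModulus t * (n + 1) + k ≤ K ^ 412 := by
    intro K hZK hkK
    have h1 : n + 1 ≤ K ^ 410 :=
      Nat.succ_le_of_lt (lt_of_lt_of_le hnN (Nat.pow_le_pow_left hZK 410))
    have h2 : smoothModulus t * (n + 1) ≤ K * K ^ 410 := Nat.mul_le_mul (hM.trans hZK) h1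
    have h3 : K ≤ K * K ^ 410 := Nat.le_mul_of_pos_right _ (Nat.pow_pos (by omega))
    have h4 : 2 * (K * K ^ 410) ≤ K * (K * K ^ 410) :=
      Nat.mul_le_mul_right _ (hZ2.trans hZK)
    calc _ ≤ 2 * (K * K ^ 410) := by omega
      _ ≤ _ := h4
      _ = K ^ 412 := by ring
  have hRl : l ≤ R * l := Nat.le_mul_of_pos_left _ hR1
  rcases le_or_gt Z k with hkZ | hkZ
  · have h1 : Nat.log 2 (smoothModulus t * (n + 1) + k) < 412 * (l + 1) := by
      refine Nat.log_lt_of_lt_pow hm0 ((hsize k hkZ le_rfl).trans_lt ?_)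
      rw [mul_comm, pow_mul]
      exact Nat.pow_lt_pow_left (Nat.lt_pow_succ_log_self (by norm_num) k) (by norm_num)
    have h2 := cardFactors_le_log hm0
    rw [mul_assoc]
    omega
  · have hg := gcd_mul_roughPart t k n
    have hg0 : (smoothModulus t).gcd k ≠ 0 :=
      (Nat.gcd_pos_of_pos_left _ (smoothModulus_pos t)).ne'
    have hr0 : roughPart t k n ≠ 0 := by
      intro h
      rw [h, mul_zero] at hg
      omega
    have h1 : ArithmeticFunction.cardFactors ((smoothModulus t).gcd k) ≤ l :=
      (cardFactors_le_log hg0).trans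
        (Nat.log_mono_right (Nat.le_of_dvd (by omega) (Nat.gcd_dvd_right _ _)))
    have h2 : ArithmeticFunction.cardFactors (roughPart t k n) < 412 * (R * l) := by
      by_contra! h
      obtain ⟨d, hd, hdR, hpow⟩ := exists_dvd_cardFactors_eq_pow_le 412 (R * l) hr0 h (by norm_num)
      have hdZ : d ≤ Z := by
        refine (Nat.pow_le_pow_iff_left (n := 412) (by norm_num)).1 (hpow.trans ?_)
        refine le_trans ?_ (hsize Z le_rfl hkZ.le)
        rw [← hg]
        exact Nat.le_mul_of_pos_left _ (Nat.pos_of_ne_zero hg0)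
      refine hdvd k (mem_Ico.2 ⟨hk, hkZ⟩) d (mem_roughDivisors.2 ⟨⟨?_, hdZ⟩, hdR, ?_⟩) hd
      · exact Nat.pos_of_dvd_of_pos hd (Nat.pos_of_ne_zero hr0)
      · exact fun p hp hpd => le_of_prime_dvd_roughPart hs hts (by omega) hn hp (hpd.trans hd)
    rw [← hg, ArithmeticFunction.cardFactors_mul hg0 hr0, mul_assoc]
    omega

end Parameters

theorem theorem1 :
    ∃ C : ℝ, 0 < C ∧
      {n : ℕ | 0 < n ∧ ∀ k : ℕ, 2 ≤ k →
        ArithmeticFunction.cardDistinctFactors (n + k) ≤ ArithmeticFunction.cardFactors (n + k) ∧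
        (ArithmeticFunction.cardFactors (n + k) : ℝ) ≤ C * Real.log (k : ℝ)}.Infinite := by
  obtain ⟨R, hR⟩ : ∃ R : ℕ, (16 / 21 : ℝ) ^ R < 1 / 256 / Real.exp 144 :=
    exists_pow_lt_of_lt_one (by positivity) (by norm_num)
  have hR' : (16 / 21 : ℝ) ^ (R + 1) * Real.exp 144 ≤ 1 / 256 := by
    rw [← le_div_iff₀ (Real.exp_pos _)]
    exact (pow_le_pow_of_le_one (by norm_num) (by norm_num) (Nat.le_succ R)).trans hR.le
  have hlog2 : 0 < Real.log 2 := Real.log_pos (by norm_num)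
  refine ⟨825 * (R + 1 : ℕ) / Real.log 2, by positivity,
    Set.infinite_of_forall_exists_gt fun a => ?_⟩
  obtain ⟨n, hn, h⟩ := exists_cardFactors_le (s := a + 3) (by omega) rfl (Nat.le_add_left 1 R) hR'
  refine ⟨n, ⟨by omega, fun k hk => ⟨cardDistinctFactors_le_cardFactors _, ?_⟩⟩, by omega⟩
  have h1 : (Nat.log 2 k : ℝ) ≤ Real.log k / Real.log 2 := by
    rw [le_div_iff₀ hlog2, ← Real.log_pow]
    refine Real.log_le_log (by positivity) ?_
    exact_mod_cast Nat.pow_log_le_self 2 (by omega)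
  calc (ArithmeticFunction.cardFactors (n + k) : ℝ)
      ≤ ((825 * (R + 1) * Nat.log 2 k : ℕ) : ℝ) := by exact_mod_cast h k hk
    _ = 825 * (R + 1 : ℕ) * (Nat.log 2 k : ℝ) := by push_cast; ring
    _ ≤ 825 * (R + 1 : ℕ) * (Real.log k / Real.log 2) :=
        mul_le_mul_of_nonneg_left h1 (by positivity)
    _ = _ := by ring
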